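/- Let $(K,\delta)$ be an algebraically closed field with a derivation $\delta:K\to K$, and assume that there is $e\in K$ with $\delta(e)=1$; fix such an $e$. Let $\pi:X\to\operatorname{Spec}K$ be a smooth $K$-variety, that is, an integral scheme which is separated, of finite type and smooth over $K$. Write $\Omega_R=\Omega_{R/\mathbb Z}$ for absolute Kähler differentials, and $\Omega_K$, $\Omega_X$, $\Omega_{X/K}$ for the absolute differentials of $K$ and $X$ and the differentials of $X$ over $K$. For a $K$-algebra $R$ let $R^{(1)}=\operatorname{Sym}_R(\Omega_R)/(da-\delta(a): a\in K)$ be its first prolongation, and let $\tau:R\to R^{(1)}$ be the derivation sending $r$ to the class of $dr$. Let $\Omega^\tau_R\subseteq R^{(1)}$ be the $R$-submodule generated by $\tau(R)$. The sheaf of $\tau$-differentials $\Omega^\tau_X$ is the sheaf of $\mathcal O_X$-modules associated with the presheaf $U\mapsto\Omega^\tau_{\mathcal O_X(U)}$ (on an affine open $\operatorname{Spec}R$ it is the quasi-coherent sheaf $(\Omega^\tau_R)^{\sim}$); $\tau$ induces a derivation $\tau:\mathcal O_X\to\Omega^\tau_X$. Then there is a commutative diagram of sheaves of $\mathcal O_X$-modules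 with exact rows $$ \begin{array}{ccccccccc} 0&\to&\pi^*\Omega_K&\xrightarrow{\ \alpha\ }&\Omega_X&\longrightarrow&\Omega_{X/K}&\to&0\\ &&\downarrow{\scriptstyle\tilde\delta}&&\downarrow{\scriptstyle\beta}&&\|&&\\ 0&\to&\mathcal O_X&\xrightarrow{\ \iota\ }&\Omega^\tau_X&\xrightarrow{\ \Lambda\ }&\Omega_{X/K}&\to&0 \end{array} $$ in which the upper row consists of the canonical maps $\alpha(r\otimes da)=r\,da$ and $df\mapsto df$, and $\tilde\delta(r\otimes da)=r\,\delta(a)$, $\beta(df)=\tau f$, $\iota(r)=r\,\tau(e)$, $\Lambda(\tau f)=df$. In particular, $\dim X$ is finite and $\Omega^\tau_X$ is a locally free $\mathcal O_X$-module of rank $\dim X+1$. -/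

import Mathlib

open CategoryTheory AlgebraicGeometry TopologicalSpace Opposite

universe u

noncomputable section

namespace TauDiff

section Algebra

variable {R S : Type u} [CommRing R] [CommRing S]

/-- The map `Ω_R → Ω_S`, `r • da ↦ f r • d (f a)`, on absolute Kähler differentials induced by a
ring homomorphism `f : R → S`. -/
def kaehlerMap (f : R →+* S) : Ω[R⁄ℤ] →ₛₗ[f] Ω[S⁄ℤ] :=
  letI := f.toAlgebra
  { toFun := KaehlerDifferential.map ℤ ℤ R S
    map_add' := map_add _
    map_smul' := fun r x => by
      rw [map_smul]
      exact algebra_compatible_smul S r (KaehlerDifferential.map ℤ ℤ R S x) }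

@[simp]
theorem kaehlerMap_D (f : R →+* S) (a : R) :
    kaehlerMap f (KaehlerDifferential.D ℤ R a) = KaehlerDifferential.D ℤ S (f a) := by
  let _ := f.toAlgebra
  exact KaehlerDifferential.map_D ℤ ℤ R S a

/-- Two semilinear maps out of `Ω_R` that agree on all `da` are equal. -/
theorem kaehler_ext {M : Type*} [AddCommGroup M] [Module S M] {f : R →+* S}
    {g h : Ω[R⁄ℤ] →ₛₗ[f] M}
    (H : ∀ a, g (KaehlerDifferential.D ℤ R a) = h (KaehlerDifferential.D ℤ R a)) : g = h := by
  ext x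
  have hx : x ∈ Submodule.span R (Set.range (KaehlerDifferential.D ℤ R)) := by
    rw [KaehlerDifferential.span_range_derivation]; trivial
  induction hx using Submodule.span_induction with
  | mem x hx => obtain ⟨a, rfl⟩ := hx; exact H a
  | zero => simp
  | add x y _ _ hx hy => rw [map_add, map_add, hx, hy]
  | smul a x _ hx => rw [map_smulₛₗ, map_smulₛₗ, hx]

/-- The ring homomorphism `Sym_R(M) → B` into an `S`-algebra `B` that is given on `R` by
`f : R → S` and on `M` by an `f`-semilinear map. -/
def symLift {M B : Type u} [AddCommGroup M] [Module R M] [CommRing B] [Algebra S B] (f : R →+* S)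
    (l : M →ₛₗ[f] B) : SymmetricAlgebra R M →+* B :=
  letI : Algebra R B := ((algebraMap S B).comp f).toAlgebra
  (SymmetricAlgebra.lift
    { toFun := l
      map_add' := map_add l
      map_smul' := fun r x => by
        rw [map_smulₛₗ, Algebra.smul_def, RingHom.id_apply, Algebra.smul_def]; rfl } :
    SymmetricAlgebra R M →ₐ[R] B).toRingHom

theorem symLift_ι {M B : Type u} [AddCommGroup M] [Module R M] [CommRing B] [Algebra S B]
    (f : R →+* S) (l : M →ₛₗ[f] B) (m : M) :
    symLift f l (SymmetricAlgebra.ι R M m) = l m := by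
  let _ : Algebra R B := ((algebraMap S B).comp f).toAlgebra
  exact SymmetricAlgebra.lift_ι_apply _ m

theorem symLift_algebraMap {M B : Type u} [AddCommGroup M] [Module R M] [CommRing B] [Algebra S B]
    (f : R →+* S) (l : M →ₛₗ[f] B) (r : R) :
    symLift f l (algebraMap R _ r) = algebraMap S B (f r) := by
  let _ : Algebra R B := ((algebraMap S B).comp f).toAlgebra
  exact AlgHom.commutes (SymmetricAlgebra.lift _ : SymmetricAlgebra R M →ₐ[R] B) r

variable {K : Type u} [Field K] (δ : Derivation ℤ K K)

/-- For a `K`-algebra `R` (with structure map `φ`), the ideal of `Sym_R(Ω_R)` generated by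
the elements `da - δ a`, `a ∈ K`. -/
def prolongationIdeal (φ : K →+* R) : Ideal (SymmetricAlgebra R Ω[R⁄ℤ]) :=
  Ideal.span (Set.range fun a : K =>
    SymmetricAlgebra.ι R Ω[R⁄ℤ] (KaehlerDifferential.D ℤ R (φ a)) -
      algebraMap R (SymmetricAlgebra R Ω[R⁄ℤ]) (φ (δ a)))

/-- The first prolongation `R⁽¹⁾ = Sym_R(Ω_R) / (da - δ a : a ∈ K)` of a `K`-algebra `R`. -/
def Prolongation (φ : K →+* R) : Type u :=
  SymmetricAlgebra R Ω[R⁄ℤ] ⧸ prolongationIdeal δ φ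

instance (φ : K →+* R) : CommRing (Prolongation δ φ) :=
  inferInstanceAs (CommRing (SymmetricAlgebra R Ω[R⁄ℤ] ⧸ prolongationIdeal δ φ))

instance (φ : K →+* R) : Algebra R (Prolongation δ φ) :=
  inferInstanceAs (Algebra R (SymmetricAlgebra R Ω[R⁄ℤ] ⧸ prolongationIdeal δ φ))

/-- The quotient map `Sym_R(Ω_R) → R⁽¹⁾`. -/
def prolongationMk (φ : K →+* R) : SymmetricAlgebra R Ω[R⁄ℤ] →ₐ[R] Prolongation δ φ :=
  Ideal.Quotient.mkₐ R (prolongationIdeal δ φ)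

theorem prolongationMk_eq_zero (φ : K →+* R) {x : SymmetricAlgebra R Ω[R⁄ℤ]}
    (hx : x ∈ prolongationIdeal δ φ) : prolongationMk δ φ x = 0 :=
  Ideal.Quotient.eq_zero_iff_mem.2 hx

/-- The `R`-linear map `Ω_R → R⁽¹⁾` sending `da` to the class of `da`. -/
def prolongationLin (φ : K →+* R) : Ω[R⁄ℤ] →ₗ[R] Prolongation δ φ :=
  (prolongationMk δ φ).toLinearMap ∘ₗ SymmetricAlgebra.ι R Ω[R⁄ℤ]

/-- The derivation `δ⁽¹⁾ : R → R⁽¹⁾`, `r ↦ dr`. -/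
def prolongationD (φ : K →+* R) : Derivation ℤ R (Prolongation δ φ) :=
  (prolongationLin δ φ).compDer (KaehlerDifferential.D ℤ R)

theorem prolongationLin_D (φ : K →+* R) (a : R) :
    prolongationLin δ φ (KaehlerDifferential.D ℤ R a) = prolongationD δ φ a := rfl

/-- `δ⁽¹⁾` prolongs the derivation `δ` of `K`. -/
theorem prolongationD_structureMap (φ : K →+* R) (a : K) :
    prolongationD δ φ (φ a) = algebraMap R (Prolongation δ φ) (φ (δ a)) := by
  rw [← sub_eq_zero]
  have h := prolongationMk_eq_zero δ φ (Ideal.subset_span ⟨a, rfl⟩)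
  rwa [map_sub, AlgHom.commutes] at h

/-- The module `Ω^τ` of a `K`-algebra `R`, realised inside `R⁽¹⁾`: the `R`-submodule of
the prolongation generated by `δ⁽¹⁾(R)`. -/
def tauSubmodule (φ : K →+* R) : Submodule R (Prolongation δ φ) :=
  Submodule.span R (Set.range (prolongationD δ φ))

/-- The universal derivation `τ : R → Ω^τ`, i.e. `δ⁽¹⁾` with restricted target. -/
def tauElem (φ : K →+* R) (r : R) : tauSubmodule δ φ :=
  ⟨prolongationD δ φ r, Submodule.subset_span ⟨r, rfl⟩⟩

/-- The `R`-linear map `β : Ω_R → Ω^τ`, `dr ↦ τ r`. -/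
def kaehlerToTau (φ : K →+* R) : Ω[R⁄ℤ] →ₗ[R] tauSubmodule δ φ :=
  LinearMap.codRestrict _ (prolongationLin δ φ) fun x => by
    have hx : x ∈ Submodule.span R (Set.range (KaehlerDifferential.D ℤ R)) := by
      rw [KaehlerDifferential.span_range_derivation]; trivial
    induction hx using Submodule.span_induction with
    | mem x hx => obtain ⟨a, rfl⟩ := hx; exact Submodule.subset_span ⟨a, rfl⟩
    | zero => rw [map_zero]; exact Submodule.zero_mem _
    | add x y _ _ hx hy => rw [map_add]; exact Submodule.add_mem _ hx hy
    | smul a x _ hx => rw [map_smul]; exact Submodule.smul_mem _ _ hx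

@[simp]
theorem kaehlerToTau_D (φ : K →+* R) (r : R) :
    kaehlerToTau δ φ (KaehlerDifferential.D ℤ R r) = tauElem δ φ r := rfl

/-- The ring homomorphism `f⁽¹⁾ : R⁽¹⁾ → S⁽¹⁾` induced by a `K`-algebra homomorphism `f : R → S`;
it extends `f` and sends `dr` to `d (f r)`. -/
def prolongationMap (φ : K →+* R) (ψ : K →+* S) (f : R →+* S) (hf : f.comp φ = ψ) :
    Prolongation δ φ →+* Prolongation δ ψ :=
  Ideal.Quotient.lift (prolongationIdeal δ φ)
    (symLift f ((prolongationLin δ ψ).comp (kaehlerMap f))) (by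
    intro x hx
    have hle : prolongationIdeal δ φ ≤
        RingHom.ker (symLift f ((prolongationLin δ ψ).comp (kaehlerMap f))) := by
      refine Ideal.span_le.2 ?_
      rintro _ ⟨a, rfl⟩
      subst hf
      rw [SetLike.mem_coe, RingHom.mem_ker, map_sub, symLift_ι, symLift_algebraMap, sub_eq_zero,
        LinearMap.comp_apply, kaehlerMap_D, prolongationLin_D]
      exact prolongationD_structureMap δ (f.comp φ) a
    exact hle hx)

theorem prolongationMap_algebraMap (φ : K →+* R) (ψ : K →+* S) (f : R →+* S)
    (hf : f.comp φ = ψ) (r : R) :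
    prolongationMap δ φ ψ f hf (algebraMap R _ r) = algebraMap S _ (f r) :=
  symLift_algebraMap f ((prolongationLin δ ψ).comp (kaehlerMap f)) r

theorem prolongationMap_D (φ : K →+* R) (ψ : K →+* S) (f : R →+* S)
    (hf : f.comp φ = ψ) (r : R) :
    prolongationMap δ φ ψ f hf (prolongationD δ φ r) = prolongationD δ ψ (f r) := by
  refine (symLift_ι f ((prolongationLin δ ψ).comp (kaehlerMap f)) _).trans ?_
  exact congrArg (prolongationLin δ ψ) (kaehlerMap_D f r)

/-- The map `Ω^τ_R → Ω^τ_S`, `r • τ a ↦ f r • τ (f a)`. -/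
def tauMap (φ : K →+* R) (ψ : K →+* S) (f : R →+* S) (hf : f.comp φ = ψ) :
    tauSubmodule δ φ →ₛₗ[f] tauSubmodule δ ψ where
  toFun x := ⟨prolongationMap δ φ ψ f hf x, by
    obtain ⟨x, hx⟩ := x
    unfold tauSubmodule at hx
    dsimp only
    induction hx using Submodule.span_induction with
    | mem x hx =>
      obtain ⟨a, rfl⟩ := hx
      rw [prolongationMap_D]
      exact Submodule.subset_span ⟨_, rfl⟩
    | zero => rw [map_zero]; exact Submodule.zero_mem _
    | add x y _ _ hx hy => rw [map_add]; exact Submodule.add_mem _ hx hy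
    | smul a x _ hx =>
      rw [Algebra.smul_def, map_mul, prolongationMap_algebraMap, ← Algebra.smul_def]
      exact Submodule.smul_mem _ _ hx⟩
  map_add' x y := Subtype.ext (map_add _ _ _)
  map_smul' r x := Subtype.ext (by
    change prolongationMap δ φ ψ f hf (r • (x : Prolongation δ φ)) = _
    rw [Algebra.smul_def, map_mul, prolongationMap_algebraMap, ← Algebra.smul_def]
    rfl)

@[simp]
theorem tauMap_tauElem (φ : K →+* R) (ψ : K →+* S) (f : R →+* S) (hf : f.comp φ = ψ) (r : R) :
    tauMap δ φ ψ f hf (tauElem δ φ r) = tauElem δ ψ (f r) :=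
  Subtype.ext (prolongationMap_D δ φ ψ f hf r)

/-- Two semilinear maps out of `Ω^τ_R` that agree on all `τ a` are equal. -/
theorem tau_ext (φ : K →+* R) {M : Type*} [AddCommGroup M] [Module S M] {f : R →+* S}
    {g h : tauSubmodule δ φ →ₛₗ[f] M}
    (H : ∀ a, g (tauElem δ φ a) = h (tauElem δ φ a)) : g = h := by
  ext ⟨x, hx⟩
  have key : ∀ y (hy : y ∈ Submodule.span R (Set.range (prolongationD δ φ))),
      g ⟨y, hy⟩ = h ⟨y, hy⟩ := by
    intro y hy
    induction hy using Submodule.span_induction with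
    | mem x hx => obtain ⟨a, rfl⟩ := hx; exact H a
    | zero => exact (map_zero g).trans (map_zero h).symm
    | add x y hx' hy' hx hy =>
      exact (map_add g ⟨x, hx'⟩ ⟨y, hy'⟩).trans
        ((congrArg₂ (· + ·) hx hy).trans (map_add h ⟨x, hx'⟩ ⟨y, hy'⟩).symm)
    | smul a x hx' hx =>
      exact (map_smulₛₗ g a ⟨x, hx'⟩).trans
        ((congrArg (f a • ·) hx).trans (map_smulₛₗ h a ⟨x, hx'⟩).symm)
  exact key x hx

/-- The module `Ω_{R/K}` of relative Kähler differentials of a `K`-algebra `R` with structure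
map `φ`. -/
def RelOmega (φ : K →+* R) : Type u :=
  letI := φ.toAlgebra
  Ω[R⁄K]

instance (φ : K →+* R) : AddCommGroup (RelOmega φ) :=
  @instAddCommGroupKaehlerDifferential K R _ _ φ.toAlgebra

instance (φ : K →+* R) : Module R (RelOmega φ) :=
  letI := φ.toAlgebra
  (inferInstance : Module R Ω[R⁄K])

/-- The universal `K`-linear derivation `R → Ω_{R/K}`. -/
def relD (φ : K →+* R) (r : R) : RelOmega φ :=
  letI := φ.toAlgebra
  KaehlerDifferential.D K R r

/-- The canonical map `Ω_R → Ω_{R/K}`, `dr ↦ dr`. -/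
def kaehlerToRel (φ : K →+* R) : Ω[R⁄ℤ] →ₗ[R] RelOmega φ :=
  letI := φ.toAlgebra
  KaehlerDifferential.map ℤ K R R

@[simp]
theorem kaehlerToRel_D (φ : K →+* R) (r : R) :
    kaehlerToRel φ (KaehlerDifferential.D ℤ R r) = relD φ r := by
  let _ := φ.toAlgebra
  exact KaehlerDifferential.map_D ℤ K R R r

/-- The map `Ω_{R/K} → Ω_{S/K}`, `r • da ↦ f r • d (f a)`, induced by a `K`-algebra
homomorphism `f : R → S`. -/
def relMap (φ : K →+* R) (ψ : K →+* S) (f : R →+* S) (hf : f.comp φ = ψ) :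
    RelOmega φ →ₛₗ[f] RelOmega ψ :=
  letI := φ.toAlgebra
  letI := ψ.toAlgebra
  letI := f.toAlgebra
  haveI : IsScalarTower K R S := IsScalarTower.of_algebraMap_eq' hf.symm
  { toFun := KaehlerDifferential.map K K R S
    map_add' := map_add (KaehlerDifferential.map K K R S)
    map_smul' := fun r x =>
      (map_smul (KaehlerDifferential.map K K R S) r x).trans
        (algebra_compatible_smul S r (KaehlerDifferential.map K K R S x)) }

@[simp]
theorem relMap_relD (φ : K →+* R) (ψ : K →+* S) (f : R →+* S) (hf : f.comp φ = ψ) (r : R) :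
    relMap φ ψ f hf (relD φ r) = relD ψ (f r) := by
  let _ := φ.toAlgebra
  let _ := ψ.toAlgebra
  let _ := f.toAlgebra
  have : IsScalarTower K R S := IsScalarTower.of_algebraMap_eq' hf.symm
  exact KaehlerDifferential.map_D K K R S r

/-- Two semilinear maps out of `Ω_{R/K}` that agree on all `da` are equal. -/
theorem rel_ext (φ : K →+* R) {M : Type*} [AddCommGroup M] [Module S M] {f : R →+* S}
    {g h : RelOmega φ →ₛₗ[f] M} (H : ∀ a, g (relD φ a) = h (relD φ a)) : g = h := by
  let _ := φ.toAlgebra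
  ext x
  have hx : x ∈ Submodule.span R (Set.range (KaehlerDifferential.D K R)) := by
    rw [KaehlerDifferential.span_range_derivation]; trivial
  induction hx using Submodule.span_induction with
  | mem x hx => obtain ⟨a, rfl⟩ := hx; exact H a
  | zero => exact (map_zero g).trans (map_zero h).symm
  | add x y _ _ hx hy =>
    exact (map_add g x y).trans ((congrArg₂ (· + ·) hx hy).trans (map_add h x y).symm)
  | smul a x _ hx =>
    exact (map_smulₛₗ g a x).trans
      ((congrArg (f a • ·) hx).trans (map_smulₛₗ h a x).symm)

/-- The `K`-linear map `Ω_K → K`, `da ↦ δ a`. -/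
def deltaLin : Ω[K⁄ℤ] →ₗ[K] K := δ.liftKaehlerDifferential

end Algebra

section Sheaves

variable {X : Scheme.{u}}

/-- The presheaf of `𝒪_X`-modules given by a `Γ(X, U)`-module `M U` for each open `U` and
functorial semilinear restriction maps. -/
def presheafMk (M : X.Opensᵒᵖ → Type u) [∀ U, AddCommGroup (M U)]
    [∀ U, Module (X.presheaf.obj U) (M U)]
    (res : ∀ {U V : X.Opensᵒᵖ} (i : U ⟶ V), M U →ₛₗ[(X.presheaf.map i).hom] M V)
    (res_id : ∀ (U : X.Opensᵒᵖ) (x : M U), res (𝟙 U) x = x)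
    (res_comp : ∀ {U V W : X.Opensᵒᵖ} (i : U ⟶ V) (j : V ⟶ W) (x : M U),
      res (i ≫ j) x = res j (res i x)) : X.PresheafOfModules where
  obj U :=
    letI : Module (X.ringCatSheaf.obj.obj U) (M U) :=
      inferInstanceAs (Module (X.presheaf.obj U) (M U))
    ModuleCat.of (X.ringCatSheaf.obj.obj U) (M U)
  map {U V} i :=
    letI : Module (X.ringCatSheaf.obj.obj U) (M U) :=
      inferInstanceAs (Module (X.presheaf.obj U) (M U))
    letI : Module (X.ringCatSheaf.obj.obj V) (M V) :=
      inferInstanceAs (Module (X.presheaf.obj V) (M V))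
    ModuleCat.ofHom
      (Y := (ModuleCat.restrictScalars (X.ringCatSheaf.obj.map i).hom).obj
        (ModuleCat.of (X.ringCatSheaf.obj.obj V) (M V)))
      { toFun := res i
        map_add' := map_add (res i)
        map_smul' := map_smulₛₗ (res i) }
  map_id U := by
    refine ConcreteCategory.hom_ext _ _ fun x => ?_
    exact res_id U x
  map_comp i j := by
    refine ConcreteCategory.hom_ext _ _ fun x => ?_
    exact res_comp i j x

/-- The sheafification functor from presheaves of modules to sheaves of modules on `X`. -/
def sheafify : X.PresheafOfModules ⥤ X.Modules :=
  PresheafOfModules.sheafification (𝟙 X.ringCatSheaf.obj)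

/-- The canonical map from a presheaf of modules to its sheafification. -/
def toSheafify (P : X.PresheafOfModules) :
    P ⟶ (Scheme.Modules.toPresheafOfModules X).obj (sheafify.obj P) :=
  (PresheafOfModules.sheafificationAdjunction (𝟙 X.ringCatSheaf.obj)).unit.app P

/-- A morphism of presheaves of modules given by compatible linear maps. -/
def presheafMkHom {M N : X.Opensᵒᵖ → Type u} [∀ U, AddCommGroup (M U)]
    [∀ U, Module (X.presheaf.obj U) (M U)] [∀ U, AddCommGroup (N U)]
    [∀ U, Module (X.presheaf.obj U) (N U)]
    {resM : ∀ {U V : X.Opensᵒᵖ} (i : U ⟶ V), M U →ₛₗ[(X.presheaf.map i).hom] M V}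
    {idM compM}
    {resN : ∀ {U V : X.Opensᵒᵖ} (i : U ⟶ V), N U →ₛₗ[(X.presheaf.map i).hom] N V}
    {idN compN}
    (l : ∀ U, M U →ₗ[X.presheaf.obj U] N U)
    (hl : ∀ {U V : X.Opensᵒᵖ} (i : U ⟶ V) (x : M U), l V (resM i x) = resN i (l U x)) :
    presheafMk M resM idM compM ⟶ presheafMk N resN idN compN where
  app U :=
    letI : Module (X.ringCatSheaf.obj.obj U) (M U) :=
      inferInstanceAs (Module (X.presheaf.obj U) (M U))
    letI : Module (X.ringCatSheaf.obj.obj U) (N U) :=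
      inferInstanceAs (Module (X.presheaf.obj U) (N U))
    ModuleCat.ofHom (R := X.ringCatSheaf.obj.obj U) (X := M U) (Y := N U)
      { toFun := l U
        map_add' := map_add (l U)
        map_smul' := map_smul (l U) }
  naturality {U V} i := by
    apply ModuleCat.hom_ext
    apply LinearMap.ext
    intro x
    exact hl i x

variable (X) in
/-- The presheaf `U ↦ Ω_{Γ(X, U)}` of absolute Kähler differentials. -/
def preOmega : X.PresheafOfModules :=
  presheafMk (fun U => Ω[X.presheaf.obj U⁄ℤ]) (fun i => kaehlerMap (X.presheaf.map i).hom)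
    (fun U x => by
      have h : kaehlerMap (X.presheaf.map (𝟙 U)).hom =
          { toFun := fun x => x
            map_add' := fun _ _ => rfl
            map_smul' := fun r x => by simp } := kaehler_ext fun a => by simp
      rw [h]; rfl)
    (fun {U V W} i j x => by
      have h : kaehlerMap (X.presheaf.map (i ≫ j)).hom =
          { toFun := fun x =>
              kaehlerMap (X.presheaf.map j).hom (kaehlerMap (X.presheaf.map i).hom x)
            map_add' := fun _ _ => by rw [map_add, map_add]
            map_smul' := fun r x => by
              rw [map_smulₛₗ, map_smulₛₗ, Functor.map_comp]; rfl } :=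
        kaehler_ext fun a => by simp
      rw [h]; rfl)

variable {K : Type u} [Field K] (δ : Derivation ℤ K K) (π : X ⟶ Spec (.of K))

/-- The ring homomorphism `K → Γ(X, U)` of a `K`-scheme `π : X ⟶ Spec K`. -/
def structureMap (U : X.Opensᵒᵖ) : K →+* X.presheaf.obj U :=
  ((Scheme.ΓSpecIso (.of K)).inv ≫ π.appLE ⊤ U.unop le_top).hom

theorem map_comp_structureMap {U V : X.Opensᵒᵖ} (i : U ⟶ V) :
    (X.presheaf.map i).hom.comp (structureMap π U) = structureMap π V := by
  unfold structureMap
  have h := π.appLE_map (U := ⊤) (V := U.unop) (V' := V.unop) le_top i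
  rw [← CommRingCat.hom_comp, Category.assoc]
  exact congrArg (fun g => ((Scheme.ΓSpecIso (.of K)).inv ≫ g).hom) h

/-- The presheaf `U ↦ Ω_{Γ(X, U)/K}` of relative Kähler differentials. -/
def preOmegaRel : X.PresheafOfModules :=
  presheafMk (fun U => RelOmega (structureMap π U))
    (fun i => relMap _ _ (X.presheaf.map i).hom (map_comp_structureMap π i))
    (fun U x => by
      have h : relMap _ _ (X.presheaf.map (𝟙 U)).hom (map_comp_structureMap π (𝟙 U)) =
          { toFun := fun x => x
            map_add' := fun _ _ => rfl
            map_smul' := fun r x => by simp } := rel_ext _ fun a => by simp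
      rw [h]; rfl)
    (fun {U V W} i j x => by
      have h : relMap _ _ (X.presheaf.map (i ≫ j)).hom (map_comp_structureMap π (i ≫ j)) =
          { toFun := fun x =>
              relMap _ _ (X.presheaf.map j).hom (map_comp_structureMap π j)
                (relMap _ _ (X.presheaf.map i).hom (map_comp_structureMap π i) x)
            map_add' := fun _ _ => by rw [map_add, map_add]
            map_smul' := fun r x => by
              rw [map_smulₛₗ, map_smulₛₗ, Functor.map_comp]; rfl } :=
        rel_ext _ fun a => by simp
      rw [h]; rfl)

/-- The presheaf `U ↦ Ω^τ` of the `K`-algebra `Γ(X, U)`. -/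
def preTau : X.PresheafOfModules :=
  presheafMk (fun U => tauSubmodule δ (structureMap π U))
    (fun i => tauMap δ _ _ (X.presheaf.map i).hom (map_comp_structureMap π i))
    (fun U x => by
      have h : tauMap δ _ _ (X.presheaf.map (𝟙 U)).hom (map_comp_structureMap π (𝟙 U)) =
          { toFun := fun x => x
            map_add' := fun _ _ => rfl
            map_smul' := fun r x => by simp } := tau_ext δ _ fun a => by simp
      rw [h]; rfl)
    (fun {U V W} i j x => by
      have h : tauMap δ _ _ (X.presheaf.map (i ≫ j)).hom (map_comp_structureMap π (i ≫ j)) =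
          { toFun := fun x =>
              tauMap δ _ _ (X.presheaf.map j).hom (map_comp_structureMap π j)
                (tauMap δ _ _ (X.presheaf.map i).hom (map_comp_structureMap π i) x)
            map_add' := fun _ _ => by rw [map_add, map_add]
            map_smul' := fun r x => by
              rw [map_smulₛₗ, map_smulₛₗ, Functor.map_comp]; rfl } :=
        tau_ext δ _ fun a => by simp
      rw [h]; rfl)

variable (X) in
/-- The sheaf `Ω_X` of absolute Kähler differentials of `X`. -/
def Omega : X.Modules := sheafify.obj (preOmega X)

/-- The sheaf `Ω_{X/K}` of relative Kähler differentials of `X` over `K`. -/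
def OmegaRel : X.Modules := sheafify.obj (preOmegaRel π)

/-- The sheaf `Ω^τ_X` of `τ`-differentials: the sheaf of `𝒪_X`-modules associated with
`U ↦ Ω^τ` of `Γ(X, U)`, the submodule of the prolongation of `Γ(X, U)` generated by the image of
`δ⁽¹⁾`. -/
def OmegaTau : X.Modules := sheafify.obj (preTau δ π)

variable (X) in
/-- The structure sheaf `𝒪_X` as a module over itself. -/
abbrev structureSheafModule : X.Modules := SheafOfModules.unit X.ringCatSheaf

/-- The pullback `π^* Ω_K` of the `𝒪_{Spec K}`-module associated with the `K`-vector space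
`Ω_K` of absolute Kähler differentials. -/
def pullbackOmega : X.Modules :=
  (Scheme.Modules.pullback π).obj (tilde (ModuleCat.of (CommRingCat.of K) Ω[K⁄ℤ]))

/-- The class in `Γ(sheafify P, U)` of a section of a presheaf of modules `P`. -/
def sheafifySection {P : X.PresheafOfModules} {U : X.Opens} (s : P.obj (op U)) :
    Γ(sheafify.obj P, U) :=
  (toSheafify P).app (op U) s

theorem sheafifySection_add {P : X.PresheafOfModules} {U : X.Opens} (s t : P.obj (op U)) :
    sheafifySection (s + t) = sheafifySection s + sheafifySection t :=
  map_add ((toSheafify P).app (op U)).hom s t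

theorem sheafifySection_smul {P : X.PresheafOfModules} {U : X.Opens}
    (r : X.ringCatSheaf.obj.obj (op U)) (s : P.obj (op U)) :
    sheafifySection (r • s) = (show Γ(X, U) from r) • sheafifySection s :=
  map_smul ((toSheafify P).app (op U)).hom r s

/-- The universal `K`-linear derivation `d : 𝒪_X → Ω_{X/K}` on sections over `U`. -/
def dRel (U : X.Opens) (f : Γ(X, U)) : Γ(OmegaRel π, U) :=
  sheafifySection (P := preOmegaRel π) (relD (structureMap π (op U)) f)

/-- The universal `τ`-derivation `τ : 𝒪_X → Ω^τ_X` on sections over `U`. -/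
def tau (U : X.Opens) (f : Γ(X, U)) : Γ(OmegaTau δ π, U) :=
  sheafifySection (P := preTau δ π) (tauElem δ (structureMap π (op U)) f)

/-- The canonical morphism `Ω_X → Ω_{X/K}`, `df ↦ df`. -/
def omegaToRel : Omega X ⟶ OmegaRel π :=
  sheafify.map (X := preOmega X) (Y := preOmegaRel π)
    (presheafMkHom (fun U => kaehlerToRel (structureMap π U)) (fun {U V} i x => by
      have h : (kaehlerToRel (structureMap π V)).comp (kaehlerMap (X.presheaf.map i).hom) =
          (relMap _ _ (X.presheaf.map i).hom (map_comp_structureMap π i)).comp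
            (kaehlerToRel (structureMap π U)) := kaehler_ext fun a => by simp
      exact LinearMap.congr_fun h x))

/-- The canonical morphism `Ω_X → Ω^τ_X`, `df ↦ τ f`. -/
def omegaToTau : Omega X ⟶ OmegaTau δ π :=
  sheafify.map (X := preOmega X) (Y := preTau δ π)
    (presheafMkHom (fun U => kaehlerToTau δ (structureMap π U)) (fun {U V} i x => by
      have h : (kaehlerToTau δ (structureMap π V)).comp (kaehlerMap (X.presheaf.map i).hom) =
          (tauMap δ _ _ (X.presheaf.map i).hom (map_comp_structureMap π i)).comp
            (kaehlerToTau δ (structureMap π U)) := kaehler_ext fun a => by simp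
      exact LinearMap.congr_fun h x))

/-- The morphism `ι : 𝒪_X → Ω^τ_X`, `r ↦ r • τ e`, for `e ∈ K`. -/
def iota (e : K) : structureSheafModule X ⟶ OmegaTau δ π :=
  (SheafOfModules.unitHomEquiv (OmegaTau δ π)).symm
    (PresheafOfModules.sectionsMk (fun U => tau δ π U.unop (structureMap π U e))
      (fun {U V} i => by
        refine (PresheafOfModules.naturality_apply (toSheafify (preTau δ π)) i
          (tauElem δ (structureMap π U) (structureMap π U e))).symm.trans ?_
        refine congrArg ((toSheafify (preTau δ π)).app V)
          ((tauMap_tauElem δ _ _ (X.presheaf.map i).hom (map_comp_structureMap π i) _).trans ?_)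
        exact congrArg (tauElem δ (structureMap π V))
          (RingHom.congr_fun (map_comp_structureMap π i) e)))

/-- The identification of the global sections of `F` with those of `π_* F`. -/
def sectionsPushforward (F : X.Modules) :
    Γ(F, ⊤) →+
      (moduleSpecΓFunctor (R := CommRingCat.of K)).obj ((Scheme.Modules.pushforward π).obj F) :=
  AddMonoidHom.mk' (fun x => (show Γ((Scheme.Modules.pushforward π).obj F, ⊤) from x))
    (fun _ _ => rfl)

theorem sectionsPushforward_smul (F : X.Modules) (a : CommRingCat.of K) (x : Γ(F, ⊤)) :
    sectionsPushforward π F (structureMap π (op ⊤) a • x) = a • sectionsPushforward π F x := by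
  have h : structureMap π (op ⊤) a =
      π.app ⊤ ((Spec (.of K)).presheaf.map (Opens.leTop ⊤).op
        ((Scheme.ΓSpecIso (.of K)).inv a)) := by
    have h1 : (Spec (.of K)).presheaf.map (Opens.leTop ⊤).op = 𝟙 _ :=
      (Spec (.of K)).presheaf.map_id _
    rw [h1]
    have h2 : π.appLE ⊤ ⊤ le_top = π.app ⊤ := Scheme.Hom.appLE_eq_app π
    change π.appLE ⊤ ⊤ le_top ((Scheme.ΓSpecIso (.of K)).inv a) = _
    rw [h2]
    rfl
  rw [h]
  rfl

/-- A semilinear map from `Ω_K` to the global sections of `F`, seen as a `K`-linear map to the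
`K`-vector space of global sections of `π_* F`. -/
def toPushforwardSections (F : X.Modules) (l : Ω[K⁄ℤ] →ₛₗ[structureMap π (op ⊤)] Γ(F, ⊤)) :
    ModuleCat.of (CommRingCat.of K) Ω[K⁄ℤ] ⟶
      (moduleSpecΓFunctor (R := CommRingCat.of K)).obj ((Scheme.Modules.pushforward π).obj F) :=
  ModuleCat.ofHom (R := CommRingCat.of K) (X := Ω[K⁄ℤ])
    (Y := (moduleSpecΓFunctor (R := CommRingCat.of K)).obj
      ((Scheme.Modules.pushforward π).obj F))
    { toFun := fun x => sectionsPushforward π F (l x)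
      map_add' := fun x y =>
        (congrArg (sectionsPushforward π F) (map_add l x y)).trans
          (map_add (sectionsPushforward π F) (l x) (l y))
      map_smul' := fun a x =>
        (congrArg (sectionsPushforward π F) (map_smulₛₗ l a x)).trans
          (sectionsPushforward_smul π F a (l x)) }

/-- The morphism `π^* Ω_K ⟶ F` of `𝒪_X`-modules corresponding under adjunction to a semilinear
map from `Ω_K` to the global sections of `F`. -/
def pullbackDesc (F : X.Modules) (l : Ω[K⁄ℤ] →ₛₗ[structureMap π (op ⊤)] Γ(F, ⊤)) :
    pullbackOmega π ⟶ F :=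
  ((Scheme.Modules.pullbackPushforwardAdjunction π).homEquiv
      (tilde (ModuleCat.of (CommRingCat.of K) Ω[K⁄ℤ])) F).symm
    ((tilde.adjunction.homEquiv (ModuleCat.of (CommRingCat.of K) Ω[K⁄ℤ])
      ((Scheme.Modules.pushforward π).obj F)).symm (toPushforwardSections π F l))

/-- The canonical morphism `α : π^* Ω_K → Ω_X`, `da ↦ da` for `a ∈ K`. -/
def pullbackToOmega : pullbackOmega π ⟶ Omega X :=
  pullbackDesc π (Omega X)
    { toFun := fun x => sheafifySection (P := preOmega X) (kaehlerMap (structureMap π (op ⊤)) x)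
      map_add' := fun x y =>
        (congrArg (sheafifySection (P := preOmega X))
          (map_add (kaehlerMap (structureMap π (op ⊤))) x y)).trans
          (sheafifySection_add (P := preOmega X) _ _)
      map_smul' := fun a x =>
        (congrArg (sheafifySection (P := preOmega X))
          (map_smulₛₗ (kaehlerMap (structureMap π (op ⊤))) a x)).trans
          (sheafifySection_smul (P := preOmega X) _ _) }

/-- The morphism `π^* Ω_K → 𝒪_X`, `da ↦ δ a` for `a ∈ K`. -/
def deltaTilde : pullbackOmega π ⟶ structureSheafModule X :=
  pullbackDesc π (structureSheafModule X)
    { toFun := fun x => structureMap π (op ⊤) (deltaLin δ x)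
      map_add' := fun x y =>
        (congrArg (structureMap π (op ⊤)) (map_add (deltaLin δ) x y)).trans
          (map_add (structureMap π (op ⊤)) _ _)
      map_smul' := fun a x =>
        (congrArg (structureMap π (op ⊤)) (map_smul (deltaLin δ) a x)).trans
          (map_mul (structureMap π (op ⊤)) a (deltaLin δ x)) }

/-- A sheaf of `𝒪_X`-modules is locally free of rank `n` if every point has an open
neighbourhood `U` such that its restriction to `U` is isomorphic to `𝒪_U^n`. -/
def IsLocallyFreeOfRank (M : X.Modules) (n : ℕ) : Prop :=
  ∀ x : X, ∃ U : X.Opens, x ∈ U ∧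
    Nonempty (M.restrict U.ι ≅
      (SheafOfModules.free (ULift.{u} (Fin n)) : SheafOfModules (U : Scheme.{u}).ringCatSheaf))

end Sheaves

end TauDiff

/-! Everything rests on one fact about a formally smooth `K`-algebra `R`. The sequence `0 → R ⊗ Ω_K
→ Ω_R → Ω_{R/K} → 0` is exact, because the first cotangent homology vanishes, and it splits, because
`Ω_{R/K}` is projective. A retraction onto `R ⊗ Ω_K` followed by `r ⊗ da ↦ r δ a` is a derivation
`D` of `R` extending `δ`. Such a `D` gives a linear map `Θ : Ω^τ → R × Ω_{R/K}` with `τ r ↦ (D r,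
dr)` (`exists_tauSplitting`).

Since `D e = 1`, the first coordinate of `Θ` shows that `τ e` has zero annihilator, so `ι` is
injective. The second coordinate shows that `β` kills only elements that die in `Ω_{R/K}`, so `Λ` is
well defined. Conversely, an element of `Ω_R` that dies in `Ω_{R/K}` is a combination of
differentials `da` with `a ∈ K`, and `τ a = δ a • τ e`. Hence the kernel of `Λ` is spanned by `τ e`.

For sheaves, injectivity, surjectivity and exactness are local, sections of a sheafification come
locally from the presheaf, and smoothness makes `K → Γ(X, V)` formally smooth for affine `V`. The
sheaf `π^* Ω_K` is brought into this form by a universal property (`pullbackOmegaIso`).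

For the rank, take an affine `V` on which `Ω_{X/K}` is free. Then `τ e` together with the `β`-images
of lifts of a basis is a basis of `Ω^τ`, and it stays one on smaller affines because restriction is
étale. Both the rank of `Ω_{X/K}` and `dim X` equal the dimension of the differentials of the
function field over `K`. For `dim X` this uses Noether normalisation and separability, available
because `δ e = 1` with `K` algebraically closed forces characteristic zero. -/

namespace TauDiff

/-! ### Differentials and `τ`-differentials of a formally smooth algebra. -/

section Algebra

open scoped TensorProduct

variable {R S : Type u} [CommRing R] [CommRing S] {K : Type u} [Field K]

/-- The base change `R ⊗_K Ω_K` of the absolute differentials of `K` to a `K`-algebra `R` with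
structure map `φ`. -/
def BaseOmega (φ : K →+* R) : Type u :=
  letI := φ.toAlgebra
  R ⊗[K] Ω[K⁄ℤ]

instance (φ : K →+* R) : AddCommGroup (BaseOmega φ) :=
  letI := φ.toAlgebra
  (inferInstance : AddCommGroup (R ⊗[K] Ω[K⁄ℤ]))

instance (φ : K →+* R) : Module R (BaseOmega φ) :=
  letI := φ.toAlgebra
  (inferInstance : Module R (R ⊗[K] Ω[K⁄ℤ]))

/-- The map `Ω_K → R ⊗_K Ω_K`, `x ↦ 1 ⊗ x`. -/
def baseIncl (φ : K →+* R) : Ω[K⁄ℤ] →ₛₗ[φ] BaseOmega φ :=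
  letI := φ.toAlgebra
  { toFun := fun x => (1 : R) ⊗ₜ[K] x
    map_add' := fun x y => TensorProduct.tmul_add _ x y
    map_smul' := fun r x => by
      refine (TensorProduct.tmul_smul r (1 : R) x).trans ?_
      exact algebra_compatible_smul R r ((1 : R) ⊗ₜ[K] x) }

/-- Two semilinear maps out of `R ⊗_K Ω_K` that agree on all `1 ⊗ x` are equal. -/
theorem base_ext (φ : K →+* R) {M : Type*} [AddCommGroup M] [Module S M] {f : R →+* S}
    {g h : BaseOmega φ →ₛₗ[f] M} (H : ∀ x, g (baseIncl φ x) = h (baseIncl φ x)) : g = h := by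
  let _ := φ.toAlgebra
  apply LinearMap.ext
  intro y
  refine TensorProduct.induction_on (motive := fun y : R ⊗[K] Ω[K⁄ℤ] => g y = h y) y ?_ ?_ ?_
  · exact (map_zero g).trans (map_zero h).symm
  · intro r x
    have hr : (r ⊗ₜ[K] x : R ⊗[K] Ω[K⁄ℤ]) = (r • baseIncl φ x : BaseOmega φ) := by
      refine Eq.trans ?_ (TensorProduct.smul_tmul' r (1 : R) x).symm
      rw [smul_eq_mul, mul_one]
    refine (congrArg g hr).trans (Eq.trans ?_ (congrArg h hr).symm)
    rw [map_smulₛₗ, map_smulₛₗ, H]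
  · intro x y hx hy
    exact (map_add g x y).trans ((congrArg₂ (· + ·) hx hy).trans (map_add h x y).symm)

/-- The linear map `R ⊗_K Ω_K → N` extending a semilinear map `Ω_K → N`. -/
def baseLift (φ : K →+* R) {N : Type*} [AddCommGroup N] [Module R N] (l : Ω[K⁄ℤ] →ₛₗ[φ] N) :
    BaseOmega φ →ₗ[R] N :=
  letI := φ.toAlgebra
  letI : Module K N := Module.compHom N φ
  haveI : IsScalarTower K R N := IsScalarTower.of_algebraMap_smul fun _ _ => rfl
  LinearMap.liftBaseChange R
    ({ toFun := l, map_add' := map_add l, map_smul' := fun r x => map_smulₛₗ l r x } :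
      Ω[K⁄ℤ] →ₗ[K] N)

@[simp]
theorem baseLift_baseIncl (φ : K →+* R) {N : Type*} [AddCommGroup N] [Module R N]
    (l : Ω[K⁄ℤ] →ₛₗ[φ] N) (x : Ω[K⁄ℤ]) : baseLift φ l (baseIncl φ x) = l x := by
  let _ := φ.toAlgebra
  let _ : Module K N := Module.compHom N φ
  have : IsScalarTower K R N := IsScalarTower.of_algebraMap_smul fun _ _ => rfl
  refine (LinearMap.liftBaseChange_tmul R _ (1 : R) x).trans ?_
  exact one_smul R (l x)

/-- The map `R ⊗_K Ω_K → S ⊗_K Ω_K` induced by a homomorphism `f : R → S` of `K`-algebras. -/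
def baseMap (φ : K →+* R) (ψ : K →+* S) (f : R →+* S) (hf : f.comp φ = ψ) :
    BaseOmega φ →ₛₗ[f] BaseOmega ψ :=
  -- Restricting scalars along `f` turns semilinear maps into `R`-linear ones, so that `baseLift`
  -- applies.
  letI : Module R (BaseOmega ψ) := Module.compHom _ f
  let g : BaseOmega φ →ₗ[R] BaseOmega ψ := baseLift φ
    { toFun := baseIncl ψ
      map_add' := map_add _
      map_smul' := fun r x => by
        rw [map_smulₛₗ, ← RingHom.congr_fun hf r]; rfl }
  { toFun := g
    map_add' := map_add g
    map_smul' := fun r x => map_smul g r x }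

@[simp]
theorem baseMap_baseIncl (φ : K →+* R) (ψ : K →+* S) (f : R →+* S) (hf : f.comp φ = ψ)
    (x : Ω[K⁄ℤ]) : baseMap φ ψ f hf (baseIncl φ x) = baseIncl ψ x := by
  let _ : Module R (BaseOmega ψ) := Module.compHom _ f
  exact baseLift_baseIncl φ _ x

/-- The canonical map `R ⊗_K Ω_K → Ω_R`, `r ⊗ da ↦ r da`. -/
def baseToKaehler (φ : K →+* R) : BaseOmega φ →ₗ[R] Ω[R⁄ℤ] := baseLift φ (kaehlerMap φ)

@[simp]
theorem baseToKaehler_baseIncl (φ : K →+* R) (x : Ω[K⁄ℤ]) :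
    baseToKaehler φ (baseIncl φ x) = kaehlerMap φ x := baseLift_baseIncl φ _ x

theorem baseToKaehler_eq (φ : K →+* R) (x : BaseOmega φ) :
    letI := φ.toAlgebra
    baseToKaehler φ x = KaehlerDifferential.mapBaseChange ℤ K R x := by
  let _ := φ.toAlgebra
  have h : baseToKaehler φ =
      (KaehlerDifferential.mapBaseChange ℤ K R : BaseOmega φ →ₗ[R] Ω[R⁄ℤ]) :=
    base_ext φ fun x => by
      rw [baseToKaehler_baseIncl]
      refine Eq.trans ?_ (KaehlerDifferential.mapBaseChange_tmul ℤ K R (1 : R) x).symm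
      rw [one_smul]
      rfl
  exact LinearMap.congr_fun h x

theorem baseToKaehler_exact (φ : K →+* R) :
    Function.Exact (baseToKaehler φ) (kaehlerToRel φ) := by
  let _ := φ.toAlgebra
  intro y
  refine (KaehlerDifferential.exact_mapBaseChange_map ℤ K R y).trans ?_
  exact exists_congr fun x => (congrArg (· = y) (baseToKaehler_eq φ x)).symm.to_iff

theorem kaehlerToRel_surjective (φ : K →+* R) : Function.Surjective (kaehlerToRel φ) := by
  let _ := φ.toAlgebra
  exact KaehlerDifferential.map_surjective ℤ K R

/-- The kernel is the image of the first cotangent homology of `R` over `K`, which is zero for a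
formally smooth algebra. -/
theorem baseToKaehler_injective (φ : K →+* R) (hφ : φ.FormallySmooth) :
    Function.Injective (baseToKaehler φ) := by
  let _ := φ.toAlgebra
  have : Algebra.FormallySmooth K R := hφ
  rw [injective_iff_map_eq_zero]
  intro x hx
  rw [baseToKaehler_eq] at hx
  obtain ⟨y, rfl⟩ := (Algebra.H1Cotangent.exact_δ_mapBaseChange ℤ K R x).1 hx
  rw [Subsingleton.elim y 0]
  exact map_zero (Algebra.H1Cotangent.δ ℤ K R)

variable (δ : Derivation ℤ K K)

/-- A derivation of `K` extends to every formally smooth `K`-algebra. -/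
theorem exists_derivation_extending (φ : K →+* R) (hφ : φ.FormallySmooth) :
    ∃ D : Derivation ℤ R R, ∀ a, D (φ a) = φ (δ a) := by
  have hproj : Module.Projective R (RelOmega φ) := by
    let _ := φ.toAlgebra
    have : Algebra.FormallySmooth K R := hφ
    exact Algebra.FormallySmooth.projective_kaehlerDifferential
  obtain ⟨s, hs⟩ := Module.projective_lifting_property (kaehlerToRel φ) LinearMap.id
    (kaehlerToRel_surjective φ)
  -- The section `s` of `Ω_R → Ω_{R/K}` yields a retraction `ρ` of `R ⊗ Ω_K → Ω_R`. The derivation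
  -- sought is `d`, then `ρ`, then `r ⊗ da ↦ r δ a`.
  obtain ⟨-, ρ, hρ⟩ := (((baseToKaehler_exact φ).split_tfae'
    ).out 0 1 rfl rfl).1 ⟨baseToKaehler_injective φ hφ, s, hs⟩
  let l : BaseOmega φ →ₗ[R] R := baseLift φ
    { toFun := fun x => φ (deltaLin δ x)
      map_add' := fun x y => by rw [map_add, map_add]
      map_smul' := fun a x => by rw [map_smul, smul_eq_mul, map_mul, smul_eq_mul] }
  refine ⟨(l ∘ₗ ρ).compDer (KaehlerDifferential.D ℤ R), fun a => ?_⟩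
  have h : KaehlerDifferential.D ℤ R (φ a) =
      baseToKaehler φ (baseIncl φ (KaehlerDifferential.D ℤ K a)) := by simp
  have h' := LinearMap.congr_fun hρ (baseIncl φ (KaehlerDifferential.D ℤ K a))
  change l (ρ (KaehlerDifferential.D ℤ R (φ a))) = _
  rw [h]
  refine (congrArg l h').trans ((baseLift_baseIncl _ _ _).trans ?_)
  exact congrArg φ (δ.liftKaehlerDifferential_comp_D a)

theorem kaehlerToTau_surjective (φ : K →+* R) : Function.Surjective (kaehlerToTau δ φ) := by
  rw [← LinearMap.range_eq_top, eq_top_iff]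
  rintro ⟨x, hx⟩ -
  have : x ∈ (LinearMap.range (kaehlerToTau δ φ)).map (tauSubmodule δ φ).subtype := by
    refine (Submodule.span_le.2 ?_) hx
    rintro _ ⟨r, rfl⟩
    exact ⟨tauElem δ φ r, ⟨KaehlerDifferential.D ℤ R r, rfl⟩, rfl⟩
  obtain ⟨y, hy, rfl⟩ := this
  exact hy

variable {δ}

/-- Inside the prolongation `τ a` is the scalar `δ a`; in particular `τ e` is `1`. -/
theorem tauElem_structureMap {e : K} (he : δ e = 1) (φ : K →+* R) (a : K) :
    tauElem δ φ (φ a) = φ (δ a) • tauElem δ φ (φ e) := by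
  refine Subtype.ext ?_
  change prolongationD δ φ (φ a) = φ (δ a) • prolongationD δ φ (φ e)
  rw [prolongationD_structureMap, prolongationD_structureMap, he, map_one, map_one,
    Algebra.algebraMap_eq_smul_one]

/-- By exactness `ω` comes from `R ⊗ Ω_K`, and there `β` is `r ⊗ da ↦ r δ a` followed by
multiplication with `τ e`. This gives exactness of the lower row in the middle. -/
theorem exists_smul_of_kaehlerToRel_eq_zero {e : K} (he : δ e = 1) (φ : K →+* R) {ω : Ω[R⁄ℤ]}
    (hω : kaehlerToRel φ ω = 0) : ∃ r : R, kaehlerToTau δ φ ω = r • tauElem δ φ (φ e) := by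
  obtain ⟨x, rfl⟩ := (baseToKaehler_exact φ ω).1 hω
  let l : BaseOmega φ →ₗ[R] R := baseLift φ
    { toFun := fun x => φ (deltaLin δ x)
      map_add' := fun x y => by rw [map_add, map_add]
      map_smul' := fun a x => by rw [map_smul, smul_eq_mul, map_mul, smul_eq_mul] }
  refine ⟨l x, ?_⟩
  have h : kaehlerToTau δ φ ∘ₗ baseToKaehler φ =
      (LinearMap.toSpanSingleton R _ (tauElem δ φ (φ e))) ∘ₗ l := by
    refine base_ext φ fun x => ?_
    have h2 : ((kaehlerToTau δ φ ∘ₗ baseToKaehler φ).comp (baseIncl φ) :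
        Ω[K⁄ℤ] →ₛₗ[φ] _) =
      ((LinearMap.toSpanSingleton R _ (tauElem δ φ (φ e))) ∘ₗ l).comp (baseIncl φ) := by
      refine kaehler_ext fun a => ?_
      simp only [LinearMap.comp_apply, baseToKaehler_baseIncl, kaehlerMap_D, kaehlerToTau_D, l,
        baseLift_baseIncl, LinearMap.toSpanSingleton_apply]
      rw [tauElem_structureMap he]
      exact congrArg (fun c => φ c • tauElem δ φ (φ e)) (δ.liftKaehlerDifferential_comp_D a).symm
    exact LinearMap.congr_fun h2 x
  exact LinearMap.congr_fun h x

/-- The map `Ω^τ → R × Ω_{R/K}`, `τ r ↦ (D r, dr)`, attached to a derivation `D` of `R` that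
extends `δ`. -/
theorem exists_tauSplitting (φ : K →+* R) (D : Derivation ℤ R R) (hD : ∀ a, D (φ a) = φ (δ a)) :
    ∃ Θ : tauSubmodule δ φ →ₗ[R] R × RelOmega φ, ∀ r, Θ (tauElem δ φ r) = (D r, relD φ r) := by
  -- The algebra structure on a trivial square-zero extension asks for a right action; it is the
  -- left one.
  let _ : Module Rᵐᵒᵖ (RelOmega φ) :=
    Module.compHom _ ((RingHom.id R).fromOpposite fun _ _ => mul_comm _ _)
  have : IsCentralScalar R (RelOmega φ) := ⟨fun _ _ => rfl⟩
  -- `Ω^τ` is only known as a submodule of the prolongation, so a map out of it is obtained by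
  -- restricting an algebra homomorphism. The square-zero extension `R ⊕ Ω_{R/K}` is a ring that can
  -- hold the pair `(D r, dr)`.
  let L : Ω[R⁄ℤ] →ₗ[R] TrivSqZeroExt R (RelOmega φ) :=
    (LinearMap.prod D.liftKaehlerDifferential (kaehlerToRel φ) :
      Ω[R⁄ℤ] →ₗ[R] R × RelOmega φ)
  have hL : ∀ r, L (KaehlerDifferential.D ℤ R r) = (D r, relD φ r) := fun r =>
    Prod.ext (D.liftKaehlerDifferential_comp_D r) (kaehlerToRel_D φ r)
  have hrel : ∀ a, relD φ (φ a) = 0 := fun a => by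
    let _ := φ.toAlgebra
    exact (KaehlerDifferential.D K R).map_algebraMap a
  let F : Prolongation δ φ →ₐ[R] TrivSqZeroExt R (RelOmega φ) :=
    Ideal.Quotient.liftₐ (prolongationIdeal δ φ) (SymmetricAlgebra.lift L) (by
      intro x hx
      -- The generators `da - δ a` go to zero since `da ↦ (D a, da) = (δ a, 0)` for `a ∈ K`.
      have hle : prolongationIdeal δ φ ≤ RingHom.ker (SymmetricAlgebra.lift L) := by
        refine Ideal.span_le.2 ?_
        rintro _ ⟨a, rfl⟩
        rw [SetLike.mem_coe, RingHom.mem_ker, map_sub, SymmetricAlgebra.lift_ι_apply,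
          AlgHom.commutes, sub_eq_zero, hL, hD, hrel]
        rfl
      exact hle hx)
  refine ⟨(F.toLinearMap ∘ₗ (tauSubmodule δ φ).subtype :
    tauSubmodule δ φ →ₗ[R] TrivSqZeroExt R (RelOmega φ)), fun r => ?_⟩
  exact (SymmetricAlgebra.lift_ι_apply L _).trans (hL r)

theorem exists_tauSplitting_kaehlerToTau (φ : K →+* R) (hφ : φ.FormallySmooth)
    {e : K} (he : δ e = 1) :
    ∃ Θ : tauSubmodule δ φ →ₗ[R] R × RelOmega φ, (Θ (tauElem δ φ (φ e))).1 = 1 ∧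
      ∀ ω, (Θ (kaehlerToTau δ φ ω)).2 = kaehlerToRel φ ω := by
  obtain ⟨D, hD⟩ := exists_derivation_extending δ φ hφ
  obtain ⟨Θ, hΘ⟩ := exists_tauSplitting φ D hD
  refine ⟨Θ, by rw [hΘ, hD, he, map_one], fun ω => ?_⟩
  have h : (LinearMap.snd R R (RelOmega φ) ∘ₗ Θ) ∘ₗ kaehlerToTau δ φ = kaehlerToRel φ :=
    kaehler_ext fun a => by simp [hΘ]
  exact LinearMap.congr_fun h ω

/-- Read off from the second coordinate of `Θ`; this is what makes `Λ` well defined. -/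
theorem kaehlerToRel_eq_zero_of_kaehlerToTau_eq_zero (φ : K →+* R) (hφ : φ.FormallySmooth)
    {e : K} (he : δ e = 1) {ω : Ω[R⁄ℤ]} (hω : kaehlerToTau δ φ ω = 0) : kaehlerToRel φ ω = 0 := by
  obtain ⟨Θ, -, h⟩ := exists_tauSplitting_kaehlerToTau φ hφ he
  rw [← h, hω, map_zero]; rfl

/-- Read off from the first coordinate of `Θ`, which sends `τ e` to `1`; this gives injectivity of
`ι`. -/
theorem eq_zero_of_smul_tauElem_eq_zero (φ : K →+* R) (hφ : φ.FormallySmooth)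
    {e : K} (he : δ e = 1) {r : R} (hr : r • tauElem δ φ (φ e) = 0) : r = 0 := by
  obtain ⟨Θ, h, -⟩ := exists_tauSplitting_kaehlerToTau φ hφ he
  have := congrArg (fun x => (Θ x).1) hr
  simpa [h] using this

end Algebra

end TauDiff

namespace TauDiff

/-! ### Krull dimension and differentials of the fraction field. -/

section Dimension

open scoped TensorProduct

/-- An injective integral extension of rings preserves the Krull dimension. -/
theorem ringKrullDim_eq_of_isIntegral (A B : Type*) [CommRing A] [CommRing B] [Algebra A B]
    [Algebra.IsIntegral A B] [FaithfulSMul A B] : ringKrullDim B = ringKrullDim A := by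
  refine le_antisymm ?_ ?_
  -- Incomparability: contraction of primes is strictly monotone.
  · refine Order.krullDim_le_of_strictMono (PrimeSpectrum.comap (algebraMap A B)) ?_
    intro P Q hPQ
    exact Ideal.IsIntegral.comap_lt_comap (R := A) (I := P.asIdeal) (J := Q.asIdeal) hPQ
  -- Lying over lifts the bottom of a chain of primes of `A`, and going up lifts the rest.
  · refine iSup_le fun l => ?_
    obtain ⟨P, hP⟩ := Algebra.IsIntegral.comap_surjective A B l.head
    have : P.asIdeal.LiesOver l.head.asIdeal := ⟨(congrArg PrimeSpectrum.asIdeal hP).symm⟩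
    obtain ⟨L, hL, -⟩ := Ideal.exists_ltSeries_of_hasGoingUp l P.asIdeal
    rw [← hL]
    exact Order.LTSeries.length_le_krullDim L

/-- The Krull dimension of a finitely generated domain over a field of characteristic zero is the
dimension of the space of differentials of its fraction field. -/
theorem ringKrullDim_eq_finrank_kaehler (K R F : Type u) [Field K] [CharZero K] [CommRing R]
    [IsDomain R] [Field F] [Algebra K R] [Algebra R F] [Algebra K F] [IsScalarTower K R F]
    [IsFractionRing R F] [Algebra.FiniteType K R] :
    ringKrullDim R = Module.finrank F Ω[F⁄K] := by
  -- Noether normalisation: `R` is integral over a polynomial ring `P` in `s` variables, so both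
  -- sides will be `s`.
  obtain ⟨s, g, hg, hint⟩ := exists_integral_inj_algHom_of_fg K R
  let P := MvPolynomial (Fin s) K
  let _ : Algebra P R := g.toRingHom.toAlgebra
  have : IsScalarTower K P R := IsScalarTower.of_algebraMap_eq fun x => (g.commutes x).symm
  have : Algebra.IsIntegral P R := ⟨hint⟩
  have : FaithfulSMul P R := (faithfulSMul_iff_algebraMap_injective P R).2 hg
  let _ : Algebra P F := ((algebraMap R F).comp (algebraMap P R)).toAlgebra
  have : IsScalarTower P R F := IsScalarTower.of_algebraMap_eq fun _ => rfl
  have : IsScalarTower K P F := IsScalarTower.of_algebraMap_eq fun x => by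
    rw [IsScalarTower.algebraMap_apply P R F, ← IsScalarTower.algebraMap_apply K P R,
      ← IsScalarTower.algebraMap_apply K R F]
  have : FaithfulSMul P F := FaithfulSMul.trans P R F
  let L := FractionRing P
  let _ : Algebra L F := FractionRing.liftAlgebra P F
  have : Algebra.IsAlgebraic L F := IsFractionRing.comap_isAlgebraic_iff.1
    ((IsFractionRing.isAlgebraic_iff' P R F).1 inferInstance)
  -- Characteristic zero makes the algebraic extension `F` of `L` separable. Hence `P → L → F` is
  -- formally étale and `Ω_{F/K}` is `F ⊗ Ω_{P/K}`.
  have : Algebra.FormallyEtale L F := Algebra.FormallyEtale.of_isSeparable L F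
  have : Algebra.FormallyEtale P L := Algebra.FormallyEtale.of_isLocalization (nonZeroDivisors P)
  have : Algebra.FormallyEtale P F := Algebra.FormallyEtale.comp P L F
  have e := KaehlerDifferential.tensorKaehlerEquivOfFormallyEtale K P F
  have b := ((KaehlerDifferential.mvPolynomialBasis K (Fin s)).baseChange F).map e
  rw [ringKrullDim_eq_of_isIntegral P R, MvPolynomial.ringKrullDim_of_isNoetherianRing,
    Module.finrank_eq_nat_card_basis b, ringKrullDim_eq_zero_of_field, zero_add]

/-- The cardinality of a basis of `Ω_{R/K}` is the dimension of the space of differentials of the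
fraction field of `R`. -/
theorem card_basis_eq_finrank_kaehler (K R F : Type u) [Field K] [CommRing R]
    [Field F] [Algebra K R] [Algebra R F] [Algebra K F] [IsScalarTower K R F]
    [IsFractionRing R F] {ι : Type*} (b : Module.Basis ι R Ω[R⁄K]) :
    Nat.card ι = Module.finrank F Ω[F⁄K] := by
  have : Algebra.FormallyEtale R F := Algebra.FormallyEtale.of_isLocalization (nonZeroDivisors R)
  exact (Module.finrank_eq_nat_card_basis ((b.baseChange F).map
    (KaehlerDifferential.tensorKaehlerEquivOfFormallyEtale K R F))).symm

/-- An algebraically closed field with a derivation that takes the value `1` has characteristic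
zero. -/
theorem charZero_of_derivation_eq_one {K : Type*} [Field K] [IsAlgClosed K] (δ : Derivation ℤ K K)
    {e : K} (he : δ e = 1) : CharZero K := by
  obtain ⟨p, hp⟩ := ExpChar.exists K
  cases hp with
  | zero => infer_instance
  | prime hp =>
    exfalso
    have : Fact p.Prime := ⟨hp⟩
    -- In characteristic `p` write `e = x ^ p`; then `δ e = p x ^ (p - 1) δ x = 0`.
    obtain ⟨x, rfl⟩ := IsAlgClosed.exists_pow_nat_eq e hp.pos
    rw [Derivation.leibniz_pow, ← Nat.cast_smul_eq_nsmul K, CharP.cast_eq_zero, zero_smul] at he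
    exact zero_ne_one he

end Dimension

end TauDiff

namespace TauDiff

/-! ### Local criteria for mono, epi and exactness of sheaves of modules. -/

section LocalCriteria

variable {X : Scheme.{u}}

theorem section_ext_of_locally_eq {M : X.Modules} {U : X.Opens} {s t : Γ(M, U)}
    (h : ∀ x ∈ U, ∃ (V : X.Opens) (i : V ⟶ U), x ∈ V ∧
      M.presheaf.map i.op s = M.presheaf.map i.op t) : s = t := by
  refine TopCat.Presheaf.IsSheaf.section_ext M.isSheaf fun x hx => ?_
  obtain ⟨V, i, hxV, hV⟩ := h x hx
  exact ⟨V, leOfHom i, hxV, hV⟩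

theorem app_map {M N : X.Modules} (f : M ⟶ N) {U V : X.Opens} (i : V ⟶ U) (s : Γ(M, U)) :
    f.app V (M.presheaf.map i.op s) = N.presheaf.map i.op (f.app U s) :=
  ConcreteCategory.congr_hom (f.mapPresheaf.naturality i.op) s

theorem mono_of_app_injective {M N : X.Modules} (f : M ⟶ N)
    (h : ∀ (U : X.Opens) (s : Γ(M, U)), f.app U s = 0 → s = 0) : Mono f := by
  refine Preadditive.mono_of_cancel_zero f fun {P} g hg => ?_
  refine Scheme.Modules.hom_ext _ _ fun U => ?_
  ext s
  refine h U _ ?_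
  exact ConcreteCategory.congr_hom (congrArg (fun k => Scheme.Modules.Hom.app k U) hg) s

theorem app_injective_of_mono {M N : X.Modules} (f : M ⟶ N) [Mono f] (U : X.Opens) :
    Function.Injective (f.app U) := by
  have : Mono ((Scheme.Modules.toPresheaf X).map f) := inferInstance
  have : Mono (((Scheme.Modules.toPresheaf X).map f).app (op U)) := inferInstance
  exact (AddCommGrpCat.mono_iff_injective _).1 this

theorem epi_of_locally_surjective {M N : X.Modules} (f : M ⟶ N)
    (h : ∀ (U : X.Opens) (s : Γ(N, U)), ∀ x ∈ U, ∃ (V : X.Opens) (i : V ⟶ U), x ∈ V ∧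
      ∃ t : Γ(M, V), f.app V t = N.presheaf.map i.op s) : Epi f := by
  refine Preadditive.epi_of_cancel_zero f fun {P} g hg => ?_
  refine Scheme.Modules.hom_ext _ _ fun U => ?_
  ext s
  refine section_ext_of_locally_eq fun x hx => ?_
  obtain ⟨V, i, hxV, t, ht⟩ := h U s x hx
  refine ⟨V, i, hxV, ?_⟩
  rw [← app_map, ← ht]
  refine (ConcreteCategory.congr_hom
    (congrArg (fun k => Scheme.Modules.Hom.app k V) hg) t).trans ?_
  exact (map_zero (P.presheaf.map i.op).hom).symm

/-- Exactness means that `S.X₁` maps epimorphically to the kernel of `S.g`. The kernel embeds into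
`S.X₂` on sections, so local lifts may be compared in `S.X₂`. -/
theorem exact_of_locally_lift (S : ShortComplex X.Modules)
    (h : ∀ (U : X.Opens) (s : Γ(S.X₂, U)), S.g.app U s = 0 → ∀ x ∈ U,
      ∃ (V : X.Opens) (i : V ⟶ U), x ∈ V ∧ ∃ t : Γ(S.X₁, V),
        S.f.app V t = S.X₂.presheaf.map i.op s) : S.Exact := by
  rw [S.exact_iff_epi_kernel_lift]
  refine epi_of_locally_surjective _ fun U s x hx => ?_
  have h0 : S.g.app U ((Limits.kernel.ι S.g).app U s) = 0 :=
    ConcreteCategory.congr_hom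
      (congrArg (fun k => Scheme.Modules.Hom.app k U) (Limits.kernel.condition S.g)) s
  obtain ⟨V, i, hxV, t, ht⟩ := h U _ h0 x hx
  refine ⟨V, i, hxV, t, ?_⟩
  apply app_injective_of_mono (Limits.kernel.ι S.g) V
  rw [app_map, ← ht]
  exact ConcreteCategory.congr_hom
      (congrArg (fun k => Scheme.Modules.Hom.app k V) (Limits.kernel.lift_ι S.g S.f S.zero)) t

theorem map_sheafifySection {P : X.PresheafOfModules} {U V : X.Opens} (i : V ⟶ U)
    (p : P.obj (op U)) :
    (sheafify.obj P).presheaf.map i.op (sheafifySection p) = sheafifySection (P.map i.op p) :=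
  (PresheafOfModules.naturality_apply (toSheafify P) i.op p).symm

theorem map_app_sheafifySection {P Q : X.PresheafOfModules} (f : P ⟶ Q) {U : X.Opens}
    (p : P.obj (op U)) :
    (sheafify.map f).app U (sheafifySection p) = sheafifySection (f.app (op U) p) :=
  (ConcreteCategory.congr_hom (congrArg (fun k => PresheafOfModules.Hom.app k (op U))
    ((PresheafOfModules.sheafificationAdjunction (𝟙 X.ringCatSheaf.obj)).unit.naturality f)) p).symm

/-- The map to the sheafification is locally surjective, and affine opens form a basis. -/
theorem exists_affine_sheafifySection_eq {P : X.PresheafOfModules} {U : X.Opens}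
    (s : Γ(sheafify.obj P, U)) {x : X} (hx : x ∈ U) :
    ∃ (V : X.Opens) (i : V ⟶ U), IsAffineOpen V ∧ x ∈ V ∧ ∃ p : P.obj (op V),
      sheafifySection p = (sheafify.obj P).presheaf.map i.op s := by
  have h : TopCat.Presheaf.IsLocallySurjective
    (CategoryTheory.toSheafify (Opens.grothendieckTopology X) P.presheaf) :=
    inferInstanceAs (Presheaf.IsLocallySurjective _ _)
  obtain ⟨W, hW, ⟨p, hp⟩, hxW⟩ :=
    (TopCat.Presheaf.isLocallySurjective_iff _).1 h U s x hx
  obtain ⟨_, ⟨V, hV, rfl⟩, hxV, hVW⟩ := X.isBasis_affineOpens.exists_subset_of_mem_open hxW W.2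
  let j : V ⟶ W := homOfLE hVW
  refine ⟨V, j ≫ homOfLE hW, hV, hxV, P.map j.op p, ?_⟩
  refine (map_sheafifySection j p).symm.trans ?_
  refine (congrArg ((sheafify.obj P).presheaf.map j.op) hp).trans ?_
  rw [op_comp, Functor.map_comp]
  rfl

/-- Local injectivity of the map to the sheafification, again refined to affine opens. -/
theorem exists_affine_map_eq_zero {P : X.PresheafOfModules} {U : X.Opens}
    {p : P.obj (op U)} (hp : sheafifySection p = 0) {x : X} (hx : x ∈ U) :
    ∃ (V : X.Opens) (i : V ⟶ U), IsAffineOpen V ∧ x ∈ V ∧ P.map i.op p = 0 := by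
  have h : Presheaf.IsLocallyInjective (Opens.grothendieckTopology X)
    (CategoryTheory.toSheafify (Opens.grothendieckTopology X) P.presheaf) := inferInstance
  obtain ⟨W, j, hj, hxW⟩ := h.equalizerSieve_mem (X := op U) (p : P.presheaf.obj (op U)) 0
    (hp.trans (map_zero ((CategoryTheory.toSheafify (Opens.grothendieckTopology X)
      P.presheaf).app (op U)).hom).symm) x hx
  obtain ⟨_, ⟨V, hV, rfl⟩, hxV, hVW⟩ := X.isBasis_affineOpens.exists_subset_of_mem_open hxW W.2
  let k : V ⟶ W := homOfLE hVW
  refine ⟨V, k ≫ j, hV, hxV, ?_⟩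
  have hj' : P.map j.op p = 0 := hj.trans (map_zero (P.presheaf.map j.op).hom)
  have hc : P.presheaf.map (k ≫ j).op = P.presheaf.map j.op ≫ P.presheaf.map k.op := by
    rw [op_comp, Functor.map_comp]
  refine (ConcreteCategory.congr_hom hc p).trans ?_
  exact (congrArg (P.presheaf.map k.op) hj').trans (map_zero (P.presheaf.map k.op).hom)

end LocalCriteria

end TauDiff

namespace TauDiff

/-! ### The pullback `π^* Ω_K` as a sheafified tensor product. -/

section PullbackOmega

variable {X : Scheme.{u}}

theorem sheafify_hom_ext {P : X.PresheafOfModules} {M : X.Modules} {f g : sheafify.obj P ⟶ M}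
    (h : ∀ (U : X.Opens) (p : P.obj (op U)),
      f.app U (sheafifySection p) = g.app U (sheafifySection p)) : f = g := by
  refine Scheme.Modules.hom_ext _ _ fun U => ?_
  ext s
  refine section_ext_of_locally_eq fun x hx => ?_
  obtain ⟨V, i, -, hxV, p, hp⟩ := exists_affine_sheafifySection_eq s hx
  exact ⟨V, i, hxV, by rw [← app_map, ← app_map, ← hp, h]⟩

/-- The morphism out of the sheafification of a presheaf of modules induced by a morphism of
presheaves. -/
def sheafifyDesc {P : X.PresheafOfModules} {M : X.Modules}
    (f : P ⟶ (Scheme.Modules.toPresheafOfModules X).obj M) : sheafify.obj P ⟶ M :=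
  ((PresheafOfModules.sheafificationAdjunction (𝟙 X.ringCatSheaf.obj)).homEquiv P M).symm f

theorem sheafifyDesc_app_sheafifySection {P : X.PresheafOfModules} {M : X.Modules}
    (f : P ⟶ (Scheme.Modules.toPresheafOfModules X).obj M) {U : X.Opens} (p : P.obj (op U)) :
    (sheafifyDesc f).app U (sheafifySection p) = f.app (op U) p := by
  have h := ((PresheafOfModules.sheafificationAdjunction (𝟙 X.ringCatSheaf.obj)).homEquiv_unit
    (X := P) (Y := M) (sheafifyDesc f)).symm.trans (Equiv.apply_symm_apply _ f)
  exact ConcreteCategory.congr_hom (congrArg (fun k => PresheafOfModules.Hom.app k (op U)) h) p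

/-- A morphism from a presheaf of modules to a sheaf of modules given by compatible linear
maps. -/
def presheafMkDesc {M : X.Opensᵒᵖ → Type u} [∀ U, AddCommGroup (M U)]
    [∀ U, Module (X.presheaf.obj U) (M U)]
    {resM : ∀ {U V : X.Opensᵒᵖ} (i : U ⟶ V), M U →ₛₗ[(X.presheaf.map i).hom] M V}
    {idM compM} (N : X.Modules)
    (l : ∀ U : X.Opens, M (op U) →ₗ[Γ(X, U)] Γ(N, U))
    (hl : ∀ {U V : X.Opens} (i : V ⟶ U) (x : M (op U)),
      l V (resM i.op x) = N.presheaf.map i.op (l U x)) :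
    presheafMk M resM idM compM ⟶ (Scheme.Modules.toPresheafOfModules X).obj N where
  app U :=
    letI : Module (X.ringCatSheaf.obj.obj U) (M U) :=
      inferInstanceAs (Module (X.presheaf.obj U) (M U))
    ModuleCat.ofHom (R := X.ringCatSheaf.obj.obj U) (X := M U) (Y := N.val.obj U)
      { toFun := l U.unop
        map_add' := map_add (l U.unop)
        map_smul' := map_smul (l U.unop) }
  naturality {U V} i := by
    apply ModuleCat.hom_ext
    apply LinearMap.ext
    intro x
    exact hl i.unop x

variable {K : Type u} [Field K] (π : X ⟶ Spec (.of K))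

/-- The semilinear map `Ω_K → Γ(F, ⊤)` corresponding under adjunction to a morphism
`π^* Ω_K ⟶ F`. -/
def pullbackSections {F : X.Modules} (f : pullbackOmega π ⟶ F) :
    Ω[K⁄ℤ] →ₛₗ[structureMap π (op ⊤)] Γ(F, ⊤) :=
  let g := tilde.adjunction.homEquiv (ModuleCat.of (CommRingCat.of K) Ω[K⁄ℤ]) _
    ((Scheme.Modules.pullbackPushforwardAdjunction π).homEquiv _ _ f)
  { toFun := fun x => (show Γ(F, ⊤) from g.hom x)
    map_add' := fun x y => map_add g.hom x y
    map_smul' := fun a x =>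
      (map_smul g.hom a x).trans (sectionsPushforward_smul π F a _).symm }

/-- Together with `pullbackSections_pullbackDesc`, this says that `π^* Ω_K` represents semilinear
maps from `Ω_K` to global sections. Both rest on the pullback-pushforward adjunction and the
adjunction between `tilde` and global sections. -/
theorem pullbackSections_injective {F : X.Modules} {f g : pullbackOmega π ⟶ F}
    (h : ∀ x, pullbackSections π f x = pullbackSections π g x) : f = g := by
  apply ((Scheme.Modules.pullbackPushforwardAdjunction π).homEquiv _ _).injective
  apply (tilde.adjunction.homEquiv (ModuleCat.of (CommRingCat.of K) Ω[K⁄ℤ]) _).injective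
  apply ModuleCat.hom_ext
  apply LinearMap.ext
  exact h

theorem pullbackSections_pullbackDesc (F : X.Modules)
    (l : Ω[K⁄ℤ] →ₛₗ[structureMap π (op ⊤)] Γ(F, ⊤)) (x : Ω[K⁄ℤ]) :
    pullbackSections π (pullbackDesc π F l) x = l x := by
  have h : tilde.adjunction.homEquiv (ModuleCat.of (CommRingCat.of K) Ω[K⁄ℤ]) _
    ((Scheme.Modules.pullbackPushforwardAdjunction π).homEquiv _ _ (pullbackDesc π F l)) =
      toPushforwardSections π F l :=
    (congrArg _ (Equiv.apply_symm_apply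
      ((Scheme.Modules.pullbackPushforwardAdjunction π).homEquiv _ _) _)).trans
      (Equiv.apply_symm_apply (tilde.adjunction.homEquiv _ _) _)
  exact ConcreteCategory.congr_hom h x

theorem pullbackSections_comp {F G : X.Modules} (f : pullbackOmega π ⟶ F) (g : F ⟶ G)
    (x : Ω[K⁄ℤ]) : pullbackSections π (f ≫ g) x = g.app ⊤ (pullbackSections π f x) := by
  have h : tilde.adjunction.homEquiv (ModuleCat.of (CommRingCat.of K) Ω[K⁄ℤ]) _
    ((Scheme.Modules.pullbackPushforwardAdjunction π).homEquiv _ _ (f ≫ g)) =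
    tilde.adjunction.homEquiv (ModuleCat.of (CommRingCat.of K) Ω[K⁄ℤ]) _
    ((Scheme.Modules.pullbackPushforwardAdjunction π).homEquiv _ _ f) ≫
      moduleSpecΓFunctor.map ((Scheme.Modules.pushforward π).map g) :=
    (congrArg _ ((Scheme.Modules.pullbackPushforwardAdjunction π).homEquiv_naturality_right
      f g)).trans (tilde.adjunction.homEquiv_naturality_right _ _)
  exact ConcreteCategory.congr_hom h x

/-- The presheaf `U ↦ Γ(X, U) ⊗_K Ω_K`. -/
def preBase : X.PresheafOfModules :=
  presheafMk (fun U => BaseOmega (structureMap π U))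
    (fun i => baseMap _ _ (X.presheaf.map i).hom (map_comp_structureMap π i))
    (fun U x => by
      have h : baseMap _ _ (X.presheaf.map (𝟙 U)).hom (map_comp_structureMap π (𝟙 U)) =
          { toFun := fun x => x
            map_add' := fun _ _ => rfl
            map_smul' := fun r x => by simp } := base_ext _ fun a => by simp
      rw [h]; rfl)
    (fun {U V W} i j x => by
      have h : baseMap _ _ (X.presheaf.map (i ≫ j)).hom (map_comp_structureMap π (i ≫ j)) =
          { toFun := fun x =>
              baseMap _ _ (X.presheaf.map j).hom (map_comp_structureMap π j)
                (baseMap _ _ (X.presheaf.map i).hom (map_comp_structureMap π i) x)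
            map_add' := fun _ _ => by rw [map_add, map_add]
            map_smul' := fun r x => by
              rw [map_smulₛₗ, map_smulₛₗ, Functor.map_comp]; rfl } :=
        base_ext _ fun a => by simp
      rw [h]; rfl)

/-- The canonical morphism from the presheaf `U ↦ Γ(X, U) ⊗_K Ω_K` to `U ↦ Ω_{Γ(X, U)}`. -/
def preBaseToOmega : preBase π ⟶ preOmega X :=
  presheafMkHom (fun U => baseToKaehler (structureMap π U)) (fun {U V} i x => by
    have h : (baseToKaehler (structureMap π V)).comp
          (baseMap _ _ (X.presheaf.map i).hom (map_comp_structureMap π i)) =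
        (kaehlerMap (X.presheaf.map i).hom).comp (baseToKaehler (structureMap π U)) := by
      refine base_ext _ fun x => ?_
      have h2 : kaehlerMap (structureMap π V) =
          { toFun := fun x => kaehlerMap (X.presheaf.map i).hom (kaehlerMap (structureMap π U) x)
            map_add' := fun _ _ => by rw [map_add, map_add]
            map_smul' := fun r x => by
              rw [map_smulₛₗ, map_smulₛₗ]
              exact congrArg (· • _) (RingHom.congr_fun (map_comp_structureMap π i) r) } :=
        kaehler_ext fun a => by
          simp only [kaehlerMap_D, LinearMap.coe_mk, AddHom.coe_mk]
          exact congrArg _ (RingHom.congr_fun (map_comp_structureMap π i) a).symm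
      simp only [LinearMap.comp_apply, baseMap_baseIncl, baseToKaehler_baseIncl]
      exact LinearMap.congr_fun h2 x
    exact LinearMap.congr_fun h x)

/-- The semilinear map `Ω_K → Γ(sheafify (preBase π), ⊤)`, `x ↦ 1 ⊗ x`. -/
def baseSections : Ω[K⁄ℤ] →ₛₗ[structureMap π (op ⊤)] Γ(sheafify.obj (preBase π), ⊤) where
  toFun x := sheafifySection (P := preBase π) (baseIncl (structureMap π (op ⊤)) x)
  map_add' x y :=
    (congrArg (sheafifySection (P := preBase π))
      (map_add (baseIncl (structureMap π (op ⊤))) x y)).trans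
      (sheafifySection_add (P := preBase π) _ _)
  map_smul' a x :=
    (congrArg (sheafifySection (P := preBase π))
      (map_smulₛₗ (baseIncl (structureMap π (op ⊤))) a x)).trans
      (sheafifySection_smul (P := preBase π) _ _)

theorem map_baseSections {U : X.Opens} (i : U ⟶ ⊤) (x : Ω[K⁄ℤ]) :
    (sheafify.obj (preBase π)).presheaf.map i.op (baseSections π x) =
      sheafifySection (P := preBase π) (baseIncl (structureMap π (op U)) x) := by
  refine (map_sheafifySection (P := preBase π) i _).trans ?_
  exact congrArg (sheafifySection (P := preBase π))
    (baseMap_baseIncl _ _ (X.presheaf.map i.op).hom (map_comp_structureMap π i.op) x)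

/-- The morphism `sheafify (preBase π) ⟶ F` attached to a semilinear map `Ω_K → Γ(F, ⊤)`. -/
def baseDesc (F : X.Modules) (l : Ω[K⁄ℤ] →ₛₗ[structureMap π (op ⊤)] Γ(F, ⊤)) :
    sheafify.obj (preBase π) ⟶ F :=
  let lU (U : X.Opens) : Ω[K⁄ℤ] →ₛₗ[structureMap π (op U)] Γ(F, U) :=
    { toFun := fun x => F.presheaf.map U.leTop.op (l x)
      map_add' := fun x y => by rw [map_add, map_add]
      map_smul' := fun a x => by
        rw [map_smulₛₗ, Scheme.Modules.map_smul]
        exact congrArg (fun r : Γ(X, U) => r • F.presheaf.map U.leTop.op (l x))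
          (RingHom.congr_fun (map_comp_structureMap π U.leTop.op) a) }
  sheafifyDesc (P := preBase π) (presheafMkDesc F
    (fun U => baseLift (R := Γ(X, U)) (structureMap π (op U)) (lU U)) (by
    intro U V i x
    let g : Γ(F, U) →ₛₗ[(X.presheaf.map i.op).hom] Γ(F, V) :=
      { toFun := fun x => F.presheaf.map i.op x
        map_add' := map_add _
        map_smul' := fun r x => F.map_smul i r x }
    have h : (baseLift (R := Γ(X, V)) (structureMap π (op V)) (lU V)).comp
          (baseMap _ _ (X.presheaf.map i.op).hom (map_comp_structureMap π i.op)) =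
        g.comp (baseLift (R := Γ(X, U)) (structureMap π (op U)) (lU U)) := by
      refine base_ext _ fun x => ?_
      simp only [LinearMap.comp_apply, baseMap_baseIncl, baseLift_baseIncl]
      refine (ConcreteCategory.congr_hom (F.presheaf.map_comp U.leTop.op i.op) (l x)).trans ?_
      rfl
    exact LinearMap.congr_fun h x))

theorem baseDesc_app (F : X.Modules) (l : Ω[K⁄ℤ] →ₛₗ[structureMap π (op ⊤)] Γ(F, ⊤))
    (U : X.Opens) (x : Ω[K⁄ℤ]) :
    (baseDesc π F l).app U
      (sheafifySection (P := preBase π) (baseIncl (structureMap π (op U)) x)) =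
      F.presheaf.map U.leTop.op (l x) :=
  (sheafifyDesc_app_sheafifySection _ _).trans (baseLift_baseIncl (R := Γ(X, U)) (structureMap π (op U)) _ x)

/-- The elements `1 ⊗ x` generate `Γ(X, U) ⊗_K Ω_K` for every `U` and are restrictions of global
sections. -/
theorem base_hom_ext {F : X.Modules} {f g : sheafify.obj (preBase π) ⟶ F}
    (h : ∀ x, f.app ⊤ (baseSections π x) = g.app ⊤ (baseSections π x)) : f = g := by
  refine sheafify_hom_ext fun U p => ?_
  let c (k : sheafify.obj (preBase π) ⟶ F) :
      BaseOmega (structureMap π (op U)) →ₗ[Γ(X, U)] Γ(F, U) :=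
    { toFun := fun p => k.app U (sheafifySection (P := preBase π) p)
      map_add' := fun p q => by
        rw [← map_add]
        exact congrArg _ (sheafifySection_add (P := preBase π) p q)
      map_smul' := fun r p =>
        (congrArg _ (sheafifySection_smul (P := preBase π) r p)).trans
          (Scheme.Modules.Hom.app_smul k r _) }
  have hc : c f = c g := base_ext _ fun x => by
    change f.app U (sheafifySection (P := preBase π) _) =
      g.app U (sheafifySection (P := preBase π) _)
    rw [← map_baseSections π U.leTop, app_map, app_map, h]
  exact LinearMap.congr_fun hc p

/-- The identification of `π^* Ω_K` with the sheaf associated with `U ↦ Γ(X, U) ⊗_K Ω_K`. -/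
def pullbackOmegaIso : pullbackOmega π ≅ sheafify.obj (preBase π) where
  -- Both sheaves represent the same functor; the two maps correspond to the two universal
  -- semilinear maps.
  hom := pullbackDesc π _ (baseSections π)
  inv := baseDesc π _ (pullbackSections π (𝟙 _))
  hom_inv_id := by
    refine pullbackSections_injective π fun x => ?_
    rw [pullbackSections_comp, pullbackSections_pullbackDesc]
    refine (baseDesc_app π _ _ ⊤ x).trans ?_
    exact ConcreteCategory.congr_hom ((pullbackOmega π).presheaf.map_id (op ⊤)) _
  inv_hom_id := by
    refine base_hom_ext π fun x => ?_
    rw [Scheme.Modules.Hom.comp_app]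
    refine (congrArg ((pullbackDesc π _ (baseSections π)).app ⊤)
      ((baseDesc_app π _ _ ⊤ x).trans (ConcreteCategory.congr_hom
        ((pullbackOmega π).presheaf.map_id (op ⊤)) _))).trans ?_
    refine (pullbackSections_comp π (𝟙 _) _ x).symm.trans ?_
    rw [Category.id_comp, pullbackSections_pullbackDesc]
    rfl

/-- The canonical morphism from the sheaf associated with `U ↦ Γ(X, U) ⊗_K Ω_K` to `Ω_X`. -/
def baseToOmega : sheafify.obj (preBase π) ⟶ Omega X := sheafify.map (preBaseToOmega π)

theorem baseToOmega_app {U : X.Opens} (p : (preBase π).obj (op U)) :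
    (baseToOmega π).app U (sheafifySection p) =
      sheafifySection (P := preOmega X) (baseToKaehler (structureMap π (op U)) p) :=
  map_app_sheafifySection (preBaseToOmega π) p

/-- This reduces `α` to the presheaf map `Γ(X, U) ⊗_K Ω_K → Ω_{Γ(X, U)}`, to which the algebra
applies. -/
theorem pullbackToOmega_eq :
    pullbackToOmega π = (pullbackOmegaIso π).hom ≫ baseToOmega π := by
  refine pullbackSections_injective π fun x => ?_
  have h₁ : pullbackSections π (pullbackToOmega π) x =
      sheafifySection (P := preOmega X) (kaehlerMap (structureMap π (op ⊤)) x) :=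
    pullbackSections_pullbackDesc π (Omega X) _ x
  have h₂ : pullbackSections π (pullbackOmegaIso π).hom x = baseSections π x :=
    pullbackSections_pullbackDesc π _ (baseSections π) x
  have h₃ : (baseToOmega π).app ⊤ (baseSections π x) =
      sheafifySection (P := preOmega X) (baseToKaehler (structureMap π (op ⊤))
        (baseIncl (structureMap π (op ⊤)) x)) :=
    baseToOmega_app π _
  have h₄ := pullbackSections_comp π (pullbackOmegaIso π).hom (baseToOmega π) x
  rw [h₂, h₃, baseToKaehler_baseIncl] at h₄
  exact h₁.trans h₄.symm

end PullbackOmega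

end TauDiff

namespace TauDiff

/-! ### Sheafifying morphisms whose behaviour is known on affine opens. -/

section SheafifyMap

variable {X : Scheme.{u}} {P Q R : X.PresheafOfModules}

theorem sheafify_map_mono (f : P ⟶ Q)
    (hf : ∀ (V : X.Opens), IsAffineOpen V → ∀ p : P.obj (op V), f.app (op V) p = 0 → p = 0) :
    Mono (sheafify.map f) := by
  refine mono_of_app_injective _ fun U s hs => section_ext_of_locally_eq fun x hx => ?_
  obtain ⟨V, i, -, hxV, p, hp⟩ := exists_affine_sheafifySection_eq s hx
  have h0 : sheafifySection (f.app (op V) p) = 0 := by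
    rw [← map_app_sheafifySection, hp, app_map, hs, map_zero]
  obtain ⟨W, j, hW, hxW, h⟩ := exists_affine_map_eq_zero h0 hxV
  have h1 : P.map j.op p = 0 :=
    hf W hW _ ((PresheafOfModules.naturality_apply f j.op p).trans h)
  refine ⟨W, j ≫ i, hxW, ?_⟩
  rw [map_zero]
  refine (ConcreteCategory.congr_hom ((sheafify.obj P).presheaf.map_comp i.op j.op) s).trans ?_
  refine (congrArg ((sheafify.obj P).presheaf.map j.op) hp.symm).trans ?_
  refine (map_sheafifySection j p).trans ?_
  rw [h1]
  exact map_zero ((toSheafify P).app (op W)).hom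

theorem sheafify_map_epi (f : P ⟶ Q)
    (hf : ∀ (V : X.Opens), IsAffineOpen V → Function.Surjective (f.app (op V))) :
    Epi (sheafify.map f) := by
  refine epi_of_locally_surjective _ fun U s x hx => ?_
  obtain ⟨V, i, hV, hxV, q, hq⟩ := exists_affine_sheafifySection_eq s hx
  obtain ⟨p, rfl⟩ := hf V hV q
  exact ⟨V, i, hxV, sheafifySection p, (map_app_sheafifySection f p).trans hq⟩

/-- A local representative of `s` is only killed by `f` up to sheafification, hence after a second
shrinking it lies in the presheaf kernel. -/
theorem exists_affine_sheafifySection_eq_of_map_eq_zero (f : P ⟶ Q) {U : X.Opens}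
    {s : Γ(sheafify.obj P, U)} (hs : (sheafify.map f).app U s = 0) {x : X} (hx : x ∈ U) :
    ∃ (V : X.Opens) (i : V ⟶ U), IsAffineOpen V ∧ x ∈ V ∧ ∃ p : P.obj (op V),
      f.app (op V) p = 0 ∧ sheafifySection p = (sheafify.obj P).presheaf.map i.op s := by
  obtain ⟨V, i, -, hxV, p, hp⟩ := exists_affine_sheafifySection_eq s hx
  have h0 : sheafifySection (f.app (op V) p) = 0 := by
    rw [← map_app_sheafifySection, hp, app_map, hs, map_zero]
  obtain ⟨W, j, hW, hxW, h⟩ := exists_affine_map_eq_zero h0 hxV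
  refine ⟨W, j ≫ i, hW, hxW, P.map j.op p,
    (PresheafOfModules.naturality_apply f j.op p).trans h, ?_⟩
  refine (map_sheafifySection j p).symm.trans ?_
  refine (congrArg ((sheafify.obj P).presheaf.map j.op) hp).trans ?_
  exact (ConcreteCategory.congr_hom ((sheafify.obj P).presheaf.map_comp i.op j.op) s).symm

end SheafifyMap

/-! ### The commutative diagram with exact rows. -/

section Diagram

variable {X : Scheme.{u}} {K : Type u} [Field K] (δ : Derivation ℤ K K) (π : X ⟶ Spec (.of K))

/-- Source of the formal smoothness hypotheses: the structure map is the isomorphism `K ≅ Γ(Spec K,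
⊤)` followed by a smooth ring map. -/
theorem smooth_structureMap [Smooth π] {V : X.Opens} (hV : IsAffineOpen V) :
    (structureMap π (op V)).Smooth := by
  refine RingHom.Smooth.comp (RingHom.Smooth.of_bijective ?_)
    (π.smooth_appLE (isAffineOpen_top (Spec (.of K))) hV le_top)
  exact ConcreteCategory.bijective_of_isIso (Scheme.ΓSpecIso (.of K)).inv

theorem omegaToTau_app {U : X.Opens} (ω : Ω[Γ(X, U)⁄ℤ]) :
    (omegaToTau δ π).app U (sheafifySection (P := preOmega X) ω) =
      sheafifySection (P := preTau δ π) (kaehlerToTau δ (structureMap π (op U)) ω) :=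
  map_app_sheafifySection (P := preOmega X) (Q := preTau δ π) _ _

theorem omegaToRel_app {U : X.Opens} (ω : Ω[Γ(X, U)⁄ℤ]) :
    (omegaToRel π).app U (sheafifySection (P := preOmega X) ω) =
      sheafifySection (P := preOmegaRel π) (kaehlerToRel (structureMap π (op U)) ω) :=
  map_app_sheafifySection (P := preOmega X) (Q := preOmegaRel π) _ _

theorem iota_app (e : K) {U : X.Opens} (r : Γ(X, U)) :
    (iota δ π e).app U r = sheafifySection (P := preTau δ π)
      (r • tauElem δ (structureMap π (op U)) (structureMap π (op U) e)) :=
  (sheafifySection_smul (P := preTau δ π) r _).symm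

instance omegaToTau_epi : Epi (omegaToTau δ π) :=
  sheafify_map_epi (P := preOmega X) (Q := preTau δ π) _ fun V _ =>
    kaehlerToTau_surjective δ (structureMap π (op V))

instance omegaToRel_epi : Epi (omegaToRel π) :=
  sheafify_map_epi (P := preOmega X) (Q := preOmegaRel π) _ fun V _ =>
    kaehlerToRel_surjective (structureMap π (op V))

theorem pullbackToOmega_comp_omegaToRel : pullbackToOmega π ≫ omegaToRel π = 0 := by
  rw [pullbackToOmega_eq, Category.assoc]
  have h : baseToOmega π ≫ omegaToRel π = 0 := by
    refine sheafify_hom_ext fun U p => ?_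
    rw [Scheme.Modules.Hom.comp_app]
    refine (congrArg ((omegaToRel π).app U)
      (baseToOmega_app π p)).trans ?_
    refine (omegaToRel_app π _).trans ?_
    refine (congrArg (sheafifySection (P := preOmegaRel π))
      ((baseToKaehler_exact (structureMap π (op U)) _).2 ⟨p, rfl⟩)).trans ?_
    exact map_zero ((toSheafify (preOmegaRel π)).app (op U)).hom
  exact (congrArg _ h).trans Limits.comp_zero

theorem pullbackToOmega_mono [Smooth π] : Mono (pullbackToOmega π) := by
  have : Mono (baseToOmega π) :=
    sheafify_map_mono (preBaseToOmega π) fun V hV p hp =>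
      baseToKaehler_injective _ (smooth_structureMap π hV).formallySmooth
        (hp.trans (map_zero _).symm)
  rw [pullbackToOmega_eq]
  exact mono_comp _ _

theorem upper_shortExact [Smooth π] :
    (ShortComplex.mk (pullbackToOmega π) (omegaToRel π)
      (pullbackToOmega_comp_omegaToRel π)).ShortExact where
  exact := by
    refine exact_of_locally_lift _ fun U s hs x hx => ?_
    obtain ⟨V, i, hV, hxV, ω, hω, hωs⟩ :=
      exists_affine_sheafifySection_eq_of_map_eq_zero (P := preOmega X) (Q := preOmegaRel π) _ hs hx
    obtain ⟨p, rfl⟩ := (baseToKaehler_exact (structureMap π (op V)) _).1 hω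
    refine ⟨V, i, hxV, (pullbackOmegaIso π).inv.app V (sheafifySection (P := preBase π) p), ?_⟩
    refine Eq.trans ?_ hωs
    have h : (pullbackOmegaIso π).inv ≫ pullbackToOmega π = baseToOmega π := by
      rw [Iso.inv_comp_eq]
      exact pullbackToOmega_eq π
    refine (ConcreteCategory.congr_hom
      (congrArg (fun k => Scheme.Modules.Hom.app k V) h) _).trans ?_
    exact baseToOmega_app π p
  mono_f := pullbackToOmega_mono π
  epi_g := omegaToRel_epi π

variable {δ} {e : K} (he : δ e = 1)

include he in
-- As `β` is an epimorphism in an abelian category, `Ω_X → Ω_{X/K}` factors through it once it kills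
-- the kernel of `β`. This is a local question, so formal smoothness is needed only on affine opens.
theorem exists_tauToRel [Smooth π] :
    ∃ Λ : OmegaTau δ π ⟶ OmegaRel π, omegaToTau δ π ≫ Λ = omegaToRel π := by
  have hS : (ShortComplex.mk (Limits.kernel.ι (omegaToTau δ π)) (omegaToTau δ π)
      (Limits.kernel.condition _)).Exact :=
    ShortComplex.exact_of_f_is_kernel _ (Limits.kernelIsKernel _)
  have hk : Limits.kernel.ι (omegaToTau δ π) ≫ omegaToRel π = 0 := by
    refine Scheme.Modules.hom_ext _ _ fun U => ?_
    ext s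
    have h0 : (omegaToTau δ π).app U ((Limits.kernel.ι (omegaToTau δ π)).app U s) = 0 :=
      ConcreteCategory.congr_hom (congrArg (fun k => Scheme.Modules.Hom.app k U)
        (Limits.kernel.condition (omegaToTau δ π))) s
    refine section_ext_of_locally_eq fun x hx => ?_
    obtain ⟨V, i, hV, hxV, ω, hω, hωs⟩ :=
      exists_affine_sheafifySection_eq_of_map_eq_zero (P := preOmega X) (Q := preTau δ π) _ h0 hx
    refine ⟨V, i, hxV, ?_⟩
    have hω' := kaehlerToRel_eq_zero_of_kaehlerToTau_eq_zero (structureMap π (op V))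
      (smooth_structureMap π hV).formallySmooth he hω
    refine ((app_map (omegaToRel π) i _).symm.trans ?_).trans
      (map_zero ((OmegaRel π).presheaf.map i.op).hom).symm
    refine (congrArg ((omegaToRel π).app V) hωs.symm).trans ?_
    refine (omegaToRel_app π ω).trans ?_
    refine (congrArg (sheafifySection (P := preOmegaRel π)) hω').trans ?_
    exact map_zero ((toSheafify (preOmegaRel π)).app (op V)).hom
  exact ⟨hS.desc (omegaToRel π) hk, hS.g_desc _ hk⟩

theorem tauToRel_app {Λ : OmegaTau δ π ⟶ OmegaRel π} (hΛ : omegaToTau δ π ≫ Λ = omegaToRel π)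
    {U : X.Opens} (ω : Ω[Γ(X, U)⁄ℤ]) :
    Λ.app U (sheafifySection (P := preTau δ π) (kaehlerToTau δ (structureMap π (op U)) ω)) =
      sheafifySection (P := preOmegaRel π) (kaehlerToRel (structureMap π (op U)) ω) := by
  rw [← omegaToTau_app, ← omegaToRel_app, ← hΛ]
  rfl

theorem tauToRel_tau {Λ : OmegaTau δ π ⟶ OmegaRel π} (hΛ : omegaToTau δ π ≫ Λ = omegaToRel π)
    (U : X.Opens) (f : Γ(X, U)) : Λ.app U (tau δ π U f) = dRel π U f := by
  refine (tauToRel_app π hΛ (KaehlerDifferential.D ℤ Γ(X, U) f)).trans ?_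
  exact congrArg (sheafifySection (P := preOmegaRel π)) (kaehlerToRel_D _ f)

/-- Here `r • τ e` is `β (r • de)`, and `de = 0` in `Ω_{X/K}`. -/
theorem iota_comp_tauToRel {Λ : OmegaTau δ π ⟶ OmegaRel π}
    (hΛ : omegaToTau δ π ≫ Λ = omegaToRel π) : iota δ π e ≫ Λ = 0 := by
  refine Scheme.Modules.hom_ext _ _ fun U => ?_
  ext r
  let φ := structureMap π (op U)
  let ω : Ω[Γ(X, U)⁄ℤ] := (show Γ(X, U) from r) • KaehlerDifferential.D ℤ Γ(X, U) (φ e)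
  have h1 : (iota δ π e).app U r = sheafifySection (P := preTau δ π) (kaehlerToTau δ φ ω) := by
    refine (iota_app δ π e r).trans (congrArg (sheafifySection (P := preTau δ π)) ?_)
    rw [map_smul, kaehlerToTau_D]
  refine (congrArg (Λ.app U) h1).trans ((tauToRel_app π hΛ ω).trans ?_)
  have h2 : kaehlerToRel φ ω = 0 := by
    let _ := φ.toAlgebra
    rw [map_smul, kaehlerToRel_D]
    exact (congrArg _ ((KaehlerDifferential.D K Γ(X, U)).map_algebraMap e)).trans (smul_zero _)
  refine (congrArg (sheafifySection (P := preOmegaRel π)) h2).trans ?_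
  exact map_zero ((toSheafify (preOmegaRel π)).app (op U)).hom

include he in
theorem iota_mono [Smooth π] : Mono (iota δ π e) := by
  refine mono_of_app_injective _ fun U r hr => section_ext_of_locally_eq fun x hx => ?_
  obtain ⟨V, i, hV, hxV, h⟩ :=
    exists_affine_map_eq_zero ((iota_app δ π e r).symm.trans hr) hx
  refine ⟨V, i, hxV, ?_⟩
  have h' : X.presheaf.map i.op r •
      tauElem δ (structureMap π (op V)) (structureMap π (op V) e) = 0 := by
    refine Eq.trans ?_ h
    refine Eq.trans ?_ (map_smulₛₗ (tauMap δ _ _ (X.presheaf.map i.op).hom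
      (map_comp_structureMap π i.op)) (show Γ(X, U) from r) _).symm
    rw [tauMap_tauElem]
    exact congrArg (fun a => X.presheaf.map i.op r • tauElem δ (structureMap π (op V)) a)
      (RingHom.congr_fun (map_comp_structureMap π i.op) e).symm
  exact (eq_zero_of_smul_tauElem_eq_zero _ (smooth_structureMap π hV).formallySmooth he h').trans
    (map_zero (X.presheaf.map i.op).hom).symm

include he in
theorem lower_shortExact [Smooth π] {Λ : OmegaTau δ π ⟶ OmegaRel π}
    (hΛ : omegaToTau δ π ≫ Λ = omegaToRel π) :
    (ShortComplex.mk (iota δ π e) Λ (iota_comp_tauToRel π hΛ)).ShortExact where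
  exact := by
    refine exact_of_locally_lift _ fun U s hs x hx => ?_
    obtain ⟨V, i, -, hxV, y, hy⟩ := exists_affine_sheafifySection_eq (P := preTau δ π) s hx
    -- Write the section as `β ω`. Since `ω` dies in the sheaf `Ω_{X/K}`, on a smaller affine it is
    -- represented by some `ω'` in the presheaf kernel, and `β ω'` is a multiple of `τ e`.
    obtain ⟨ω, rfl⟩ := kaehlerToTau_surjective δ (structureMap π (op V)) y
    have h0 : (omegaToRel π).app V (sheafifySection (P := preOmega X) ω) = 0 := by
      refine (omegaToRel_app π ω).trans ((tauToRel_app π hΛ ω).symm.trans ?_)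
      refine (congrArg (Λ.app V) hy).trans ((app_map Λ i s).trans ?_)
      exact (congrArg ((OmegaRel π).presheaf.map i.op) hs).trans
        (map_zero ((OmegaRel π).presheaf.map i.op).hom)
    obtain ⟨W, j, hW, hxW, ω', hω', hωs⟩ :=
      exists_affine_sheafifySection_eq_of_map_eq_zero (P := preOmega X) (Q := preOmegaRel π)
        _ h0 hxV
    obtain ⟨r, hr⟩ := exists_smul_of_kaehlerToRel_eq_zero he (structureMap π (op W)) hω'
    refine ⟨W, j ≫ i, hxW, r, (iota_app δ π e r).trans ?_⟩
    refine (congrArg (sheafifySection (P := preTau δ π)) hr.symm).trans ?_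
    refine (omegaToTau_app δ π ω').symm.trans ?_
    refine (congrArg ((omegaToTau δ π).app W) hωs).trans ((app_map (omegaToTau δ π) j _).trans ?_)
    refine (congrArg ((OmegaTau δ π).presheaf.map j.op)
      ((omegaToTau_app δ π ω).trans hy)).trans ?_
    exact (ConcreteCategory.congr_hom ((OmegaTau δ π).presheaf.map_comp i.op j.op) s).symm
  mono_f := iota_mono π he
  epi_g := epi_of_epi_fac hΛ

include he in
theorem kaehlerToTau_kaehlerMap {R : Type u} [CommRing R] (φ : K →+* R) (x : Ω[K⁄ℤ]) :
    kaehlerToTau δ φ (kaehlerMap φ x) = φ (deltaLin δ x) • tauElem δ φ (φ e) := by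
  have h : (kaehlerToTau δ φ).comp (kaehlerMap φ) =
      { toFun := fun x => φ (deltaLin δ x) • tauElem δ φ (φ e)
        map_add' := fun x y => by rw [map_add, map_add, add_smul]
        map_smul' := fun a x => by rw [map_smul, smul_eq_mul, map_mul, mul_smul] } := by
    refine kaehler_ext fun a => ?_
    simp only [LinearMap.comp_apply, kaehlerMap_D, kaehlerToTau_D, LinearMap.coe_mk,
      AddHom.coe_mk]
    rw [tauElem_structureMap he]
    exact congrArg (fun c => φ c • tauElem δ φ (φ e)) (δ.liftKaehlerDifferential_comp_D a).symm
  exact LinearMap.congr_fun h x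

include he in
-- By the universal property of `π^* Ω_K` it suffices to compare global sections, where both sides
-- are `da ↦ δ a • τ e`.
theorem pullbackToOmega_comp_omegaToTau :
    pullbackToOmega π ≫ omegaToTau δ π = deltaTilde δ π ≫ iota δ π e := by
  refine pullbackSections_injective π fun x => ?_
  refine (pullbackSections_comp π (pullbackToOmega π) (omegaToTau δ π) x).trans
    (Eq.trans ?_ (pullbackSections_comp π (deltaTilde δ π) (iota δ π e) x).symm)
  have h₁ : pullbackSections π (pullbackToOmega π) x =
      sheafifySection (P := preOmega X) (kaehlerMap (structureMap π (op ⊤)) x) :=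
    pullbackSections_pullbackDesc π (Omega X) _ x
  have h₂ : pullbackSections π (deltaTilde δ π) x = structureMap π (op ⊤) (deltaLin δ x) :=
    pullbackSections_pullbackDesc π (structureSheafModule X) _ x
  refine (congrArg ((omegaToTau δ π).app ⊤) h₁).trans ?_
  refine Eq.trans ?_ (congrArg ((iota δ π e).app ⊤) h₂).symm
  refine (omegaToTau_app δ π _).trans (Eq.trans ?_ (iota_app δ π e _).symm)
  exact congrArg (sheafifySection (P := preTau δ π)) (kaehlerToTau_kaehlerMap he _ x)

end Diagram

end TauDiff

namespace TauDiff

/-! ### Bases of `Ω^τ` and their behaviour under étale maps. -/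

section TauBasis

variable {R S : Type u} [CommRing R] [CommRing S] {K : Type u} [Field K]

/-- If `Ω_{R/K}` is free, then so is `Ω^τ_R`: a basis is given by `τ e` and the images of lifts to
`Ω_R` of a basis of `Ω_{R/K}`. -/
theorem exists_basis_tauSubmodule {δ : Derivation ℤ K K} {e : K} (he : δ e = 1) (φ : K →+* R)
    (hφ : φ.FormallySmooth) {n : ℕ} (b : Module.Basis (Fin n) R (RelOmega φ))
    (ω : Fin n → Ω[R⁄ℤ]) (hω : ∀ j, kaehlerToRel φ (ω j) = b j) :
    ∃ c : Module.Basis (Fin (n + 1)) R (tauSubmodule δ φ), ∀ i,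
      c i = Fin.cons (α := fun _ => tauSubmodule δ φ) (tauElem δ φ (φ e))
        (fun j => kaehlerToTau δ φ (ω j)) i := by
  let t : Fin (n + 1) → tauSubmodule δ φ :=
    Fin.cons (α := fun _ => tauSubmodule δ φ) (tauElem δ φ (φ e))
        (fun j => kaehlerToTau δ φ (ω j))
  have hli : LinearIndependent R t := by
    rw [Fintype.linearIndependent_iff]
    intro a ha
    rw [Fin.sum_univ_succ] at ha
    simp only [t, Fin.cons_zero, Fin.cons_succ] at ha
    -- A relation is `β` of an element of `Ω_R`. Its image in `Ω_{R/K}` vanishes, which kills all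
    -- coefficients except that of `τ e`.
    have h1 : kaehlerToTau δ φ (a 0 • KaehlerDifferential.D ℤ R (φ e) +
        ∑ j, a (Fin.succ j) • ω j) = 0 := by
      rw [map_add, map_smul, kaehlerToTau_D, map_sum]
      simpa only [map_smul] using ha
    have h2 := kaehlerToRel_eq_zero_of_kaehlerToTau_eq_zero φ hφ he h1
    have h3 : relD φ (φ e) = 0 := by
      let _ := φ.toAlgebra
      exact (KaehlerDifferential.D K R).map_algebraMap e
    rw [map_add, map_smul, kaehlerToRel_D, h3, smul_zero, zero_add, map_sum] at h2
    simp only [map_smul, hω] at h2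
    have h4 : ∀ j : Fin n, a j.succ = 0 := Fintype.linearIndependent_iff.1 b.linearIndependent _ h2
    simp only [h4, zero_smul, Finset.sum_const_zero, add_zero] at ha
    intro i
    refine Fin.cases ?_ h4 i
    exact eq_zero_of_smul_tauElem_eq_zero φ hφ he ha
  have hsp : ⊤ ≤ Submodule.span R (Set.range t) := by
    rintro y -
    obtain ⟨x, rfl⟩ := kaehlerToTau_surjective δ φ y
    let a := b.repr (kaehlerToRel φ x)
    -- Subtracting the lift of its image in `Ω_{R/K}` leaves an element that `β` sends to a multiple
    -- of `τ e`.
    have h1 : kaehlerToRel φ (x - ∑ j, a j • ω j) = 0 := by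
      rw [map_sub, map_sum]
      simp only [map_smul, hω]
      rw [b.sum_repr, sub_self]
    obtain ⟨r, hr⟩ := exists_smul_of_kaehlerToRel_eq_zero he φ h1
    rw [map_sub, sub_eq_iff_eq_add, map_sum] at hr
    rw [hr]
    refine Submodule.add_mem _ (Submodule.smul_mem _ _ (Submodule.subset_span ⟨0, rfl⟩))
      (Submodule.sum_mem _ fun j _ => ?_)
    rw [map_smul]
    exact Submodule.smul_mem _ _ (Submodule.subset_span ⟨j.succ, rfl⟩)
  exact ⟨Module.Basis.mk hli hsp, fun i => Module.Basis.mk_apply hli hsp i⟩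

/-- A basis of `Ω_{R/K}` is mapped to a basis of `Ω_{S/K}` by a formally étale homomorphism
`R → S` of `K`-algebras. -/
theorem exists_basis_relOmega (φ : K →+* R) (ψ : K →+* S) (f : R →+* S) (hf : f.comp φ = ψ)
    (hfe : f.FormallyEtale) {ι : Type*} (b : Module.Basis ι R (RelOmega φ)) :
    ∃ c : Module.Basis ι S (RelOmega ψ), ∀ i, c i = relMap φ ψ f hf (b i) := by
  let _ := φ.toAlgebra
  let _ := ψ.toAlgebra
  let _ := f.toAlgebra
  have : IsScalarTower K R S := IsScalarTower.of_algebraMap_eq' hf.symm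
  have : Algebra.FormallyEtale R S := hfe
  let b' : Module.Basis ι R Ω[R⁄K] := b
  let c : Module.Basis ι S Ω[S⁄K] :=
    (b'.baseChange S).map (KaehlerDifferential.tensorKaehlerEquivOfFormallyEtale K R S)
  have hc : ∀ i, c i = KaehlerDifferential.map K K R S (b' i) := fun i => by
    rw [Module.Basis.map_apply, Module.Basis.baseChange_apply]
    refine (KaehlerDifferential.mapBaseChange_tmul K R S (1 : S) (b' i)).trans ?_
    rw [one_smul]
  exact ⟨c, hc⟩

/-- If `Ω_{R/K}` is free of rank `n`, then there are `n + 1` elements of `Ω^τ_R` whose images form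
a basis of `Ω^τ_S` for all formally étale homomorphisms `R → S` into a formally smooth
`K`-algebra `S`. -/
theorem exists_family_basis_tauSubmodule {δ : Derivation ℤ K K} {e : K} (he : δ e = 1)
    (φ : K →+* R) {n : ℕ} (b : Module.Basis (Fin n) R (RelOmega φ)) :
    ∃ t : Fin (n + 1) → tauSubmodule δ φ, ∀ {S : Type u} [CommRing S] (ψ : K →+* S) (f : R →+* S)
      (hf : f.comp φ = ψ), ψ.FormallySmooth → f.FormallyEtale →
      ∃ c : Module.Basis (Fin (n + 1)) S (tauSubmodule δ ψ), ∀ i, c i = tauMap δ φ ψ f hf (t i) := by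
  -- The lifts are chosen once over `R`; their images in `Ω_S` lift the induced basis of `Ω_{S/K}`,
  -- whatever `S` is.
  choose ω hω using fun j => kaehlerToRel_surjective φ (b j)
  refine ⟨Fin.cons (α := fun _ => tauSubmodule δ φ) (tauElem δ φ (φ e))
    (fun j => kaehlerToTau δ φ (ω j)), fun {S} _ ψ f hf hψ hfe => ?_⟩
  obtain ⟨b', hb'⟩ := exists_basis_relOmega φ ψ f hf hfe b
  have h₁ : ∀ x, kaehlerToRel ψ (kaehlerMap f x) = relMap φ ψ f hf (kaehlerToRel φ x) :=
    LinearMap.congr_fun (f := (kaehlerToRel ψ).comp (kaehlerMap f))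
      (g := (relMap φ ψ f hf).comp (kaehlerToRel φ)) (kaehler_ext fun a => by simp)
  have h₂ : ∀ x, kaehlerToTau δ ψ (kaehlerMap f x) = tauMap δ φ ψ f hf (kaehlerToTau δ φ x) :=
    LinearMap.congr_fun (f := (kaehlerToTau δ ψ).comp (kaehlerMap f))
      (g := (tauMap δ φ ψ f hf).comp (kaehlerToTau δ φ)) (kaehler_ext fun a => by simp)
  obtain ⟨c, hc⟩ := exists_basis_tauSubmodule he ψ hψ b' (fun j => kaehlerMap f (ω j))
    fun j => by rw [h₁, hω, hb']
  refine ⟨c, fun i => (hc i).trans ?_⟩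
  refine Fin.cases ?_ (fun j => h₂ (ω j)) i
  refine Eq.trans ?_ (tauMap_tauElem δ φ ψ f hf (φ e)).symm
  exact congrArg (tauElem δ ψ) (RingHom.congr_fun hf e).symm

end TauBasis

end TauDiff

namespace TauDiff

/-! ### A criterion for a sheaf of modules to be free. -/

section Free

variable {X : Scheme.{u}}

/-- The morphism `𝒪_X → M`, `r ↦ r • s`, attached to a global section `s` of `M`. -/
def unitDesc {M : X.Modules} (s : Γ(M, ⊤)) : structureSheafModule X ⟶ M :=
  (SheafOfModules.unitHomEquiv M).symm
    (PresheafOfModules.sectionsMk (fun _ => M.presheaf.map (homOfLE le_top).op s)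
      (fun {_ _} i => (ConcreteCategory.congr_hom
        (M.presheaf.map_comp (homOfLE le_top).op i) s).symm))

theorem unitDesc_app {M : X.Modules} (s : Γ(M, ⊤)) {U : X.Opens} (r : Γ(X, U)) :
    (unitDesc s).app U r = r • M.presheaf.map (homOfLE le_top).op s := rfl

theorem sum_app {M N : X.Modules} {ι : Type*} (J : Finset ι) (f : ι → (M ⟶ N)) (U : X.Opens)
    (s : Γ(M, U)) : (∑ i ∈ J, f i).app U s = ∑ i ∈ J, (f i).app U s := by
  classical
  induction J using Finset.induction_on with
  | empty => simp
  | insert i J hi h =>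
    rw [Finset.sum_insert hi, Finset.sum_insert hi, ← h]
    rfl

/-- The free `𝒪_X`-module on a type. -/
abbrev freeModule (X : Scheme.{u}) (I : Type u) : X.Modules :=
  (SheafOfModules.free I : SheafOfModules X.ringCatSheaf)

/-- The standard coproduct inclusion into a free module. -/
abbrev freeIncl {I : Type u} (i : I) : structureSheafModule X ⟶ freeModule X I :=
  SheafOfModules.ιFree i

/-- The morphism from a free module given by a family of morphisms from the structure sheaf. -/
def freeDesc {I : Type u} {M : X.Modules} (σ : I → (structureSheafModule X ⟶ M)) :
    freeModule X I ⟶ M :=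
  Limits.Cofan.IsColimit.desc (SheafOfModules.isColimitFreeCofan I) σ

theorem freeIncl_freeDesc {I : Type u} {M : X.Modules} (σ : I → (structureSheafModule X ⟶ M))
    (i : I) : freeIncl i ≫ freeDesc σ = σ i :=
  Limits.Cofan.IsColimit.fac (SheafOfModules.isColimitFreeCofan I) σ i

theorem free_hom_ext {I : Type u} {M : X.Modules} {f g : freeModule X I ⟶ M}
    (h : ∀ i, freeIncl i ≫ f = freeIncl i ≫ g) : f = g :=
  Limits.Cofan.IsColimit.hom_ext (SheafOfModules.isColimitFreeCofan I) _ _ h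

open Classical in
/-- The coordinate projection of a free module. -/
def freeProj {I : Type u} (i : I) : freeModule X I ⟶ structureSheafModule X :=
  freeDesc fun j => if j = i then 𝟙 _ else 0

/-- A finite coproduct is a biproduct; this gives every section of the free module its coordinates.
-/
theorem sum_freeProj_freeIncl {I : Type u} [Fintype I] :
    ∑ i, freeProj (X := X) i ≫ freeIncl i = 𝟙 (freeModule X I) := by
  classical
  refine free_hom_ext fun j => ?_
  rw [Preadditive.comp_sum, Category.comp_id]
  simp_rw [← Category.assoc]
  rw [Finset.sum_eq_single j]
  · rw [freeProj, freeIncl_freeDesc, if_pos rfl, Category.id_comp]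
  · intro i _ hi
    rw [freeProj, freeIncl_freeDesc, if_neg hi.symm, Limits.zero_comp]
  · simp

theorem sum_freeIncl_freeProj_app {I : Type u} [Fintype I] {U : X.Opens}
    (t : Γ(freeModule X I, U)) :
    ∑ i, (freeIncl i).app U ((freeProj (X := X) i).app U t) = t := by
  have h := ConcreteCategory.congr_hom
    (congrArg (fun k => Scheme.Modules.Hom.app k U) (sum_freeProj_freeIncl (X := X) (I := I))) t
  exact (sum_app Finset.univ (fun i => freeProj (X := X) i ≫ freeIncl i) U t).symm.trans h

/-- A sheaf of modules is free if it has finitely many global sections that are linearly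
independent over every open subset and generate locally. -/
theorem nonempty_iso_free {I : Type u} [Fintype I] {M : X.Modules} (s : I → Γ(M, ⊤))
    (hli : ∀ (U : X.Opens) (a : I → Γ(X, U)),
      ∑ i, a i • M.presheaf.map (homOfLE (le_top : U ≤ ⊤)).op (s i) = 0 → ∀ i, a i = 0)
    (hsp : ∀ (U : X.Opens) (m : Γ(M, U)), ∀ x ∈ U, ∃ (V : X.Opens) (i : V ⟶ U), x ∈ V ∧
      ∃ a : I → Γ(X, V), ∑ j, a j • M.presheaf.map (homOfLE (le_top : V ≤ ⊤)).op (s j) =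
        M.presheaf.map i.op m) : Nonempty (M ≅ freeModule X I) := by
  -- The map `(r i) ↦ ∑ r i • s i` is mono by independence and epi by local generation, hence an
  -- isomorphism.
  let F : freeModule X I ⟶ M := freeDesc fun i => unitDesc (s i)
  have hF : ∀ (U : X.Opens) (i : I) (r : Γ(X, U)), F.app U ((freeIncl i).app U r) =
      r • M.presheaf.map (homOfLE (le_top : U ≤ ⊤)).op (s i) := fun U i r =>
    (ConcreteCategory.congr_hom (congrArg (fun k => Scheme.Modules.Hom.app k U)
      (freeIncl_freeDesc (fun i => unitDesc (s i)) i)) r).trans (unitDesc_app (s i) r)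
  have : Mono F := by
    refine mono_of_app_injective _ fun U t ht => ?_
    have h := sum_freeIncl_freeProj_app t
    rw [← h] at ht ⊢
    rw [map_sum] at ht
    refine Finset.sum_eq_zero fun i _ => ?_
    have h0 : (freeProj (X := X) i).app U t = 0 :=
      hli U (fun i => (freeProj (X := X) i).app U t)
        ((Finset.sum_congr rfl fun i _ => (hF U i _).symm).trans ht) i
    exact (congrArg _ h0).trans (map_zero ((freeIncl (X := X) i).app U).hom)
  have : Epi F := by
    refine epi_of_locally_surjective _ fun U m x hx => ?_
    obtain ⟨V, i, hxV, a, ha⟩ := hsp U m x hx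
    refine ⟨V, i, hxV, ∑ j, (freeIncl j).app V (a j), ?_⟩
    rw [← ha, map_sum]
    exact Finset.sum_congr rfl fun j _ => hF V j (a j)
  have : IsIso F := isIso_of_mono_of_epi F
  exact ⟨(asIso F).symm⟩

end Free

end TauDiff

namespace TauDiff

/-! ### Freeness of a restriction, tested on opens of the ambient scheme. -/

section Restrict

variable {X : Scheme.{u}}

/-- The restriction of a sheaf of modules to an open subset `V` is free if there are finitely many
sections over `V` that are linearly independent over every open subset of `V` and generate
locally. -/
theorem nonempty_restrict_iso_free {I : Type u} [Fintype I] {M : X.Modules} {V : X.Opens}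
    (s : I → Γ(M, V))
    (hli : ∀ (U : X.Opens) (k : U ⟶ V) (a : I → Γ(X, U)),
      ∑ i, a i • M.presheaf.map k.op (s i) = 0 → ∀ i, a i = 0)
    (hsp : ∀ (U : X.Opens) (k : U ⟶ V) (m : Γ(M, U)), ∀ x ∈ U,
      ∃ (W : X.Opens) (i : W ⟶ U), x ∈ W ∧
        ∃ a : I → Γ(X, W), ∑ j, a j • M.presheaf.map (i ≫ k).op (s j) =
          M.presheaf.map i.op m) : Nonempty (M.restrict V.ι ≅ freeModule V I) := by
  let s' : I → Γ(M.restrict V.ι, ⊤) := fun j =>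
    M.presheaf.map (homOfLE (V.ι_image_le ⊤)).op (s j)
  have hs' : ∀ (U : V.toScheme.Opens) (j : I),
      (M.restrict V.ι).presheaf.map (homOfLE (le_top : U ≤ ⊤)).op (s' j) =
        M.presheaf.map (homOfLE (V.ι_image_le U)).op (s j) := fun U j =>
    (ConcreteCategory.congr_hom (M.presheaf.map_comp (homOfLE (V.ι_image_le ⊤)).op
      (V.ι.opensFunctor.map (homOfLE (le_top : U ≤ ⊤))).op) (s j)).symm
  have hterm : ∀ (U : V.toScheme.Opens) (r : Γ(V, U)) (j : I),
      r • (M.restrict V.ι).presheaf.map (homOfLE (le_top : U ≤ ⊤)).op (s' j) =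
        (show Γ(X, V.ι ''ᵁ U) from r) • M.presheaf.map (homOfLE (V.ι_image_le U)).op (s j) :=
      fun U r j => by
    rw [hs']
    -- Scalars act on the restricted sheaf through the inverse of `appIso`, which is the identity
    -- for the inclusion of an open subscheme.
    have h : (V.ι.appIso U).inv r = r := by rw [Scheme.Opens.ι_appIso]; rfl
    exact congrArg (fun r' : Γ(X, V.ι ''ᵁ U) =>
      r' • M.presheaf.map (homOfLE (V.ι_image_le U)).op (s j)) h
  refine nonempty_iso_free s' (fun U a ha => ?_) (fun U m x hx => ?_)
  · refine hli (V.ι ''ᵁ U) (homOfLE (V.ι_image_le U)) a (Eq.trans ?_ ha)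
    exact Finset.sum_congr rfl fun j _ => (hterm U (a j) j).symm
  · obtain ⟨W, i, hxW, a, ha⟩ := hsp (V.ι ''ᵁ U) (homOfLE (V.ι_image_le U)) m x.1 ⟨x, hx, rfl⟩
    have hW : V.ι ''ᵁ V.ι ⁻¹ᵁ W ≤ W := by
      rintro _ ⟨y, hy, rfl⟩
      exact hy
    have hWU : V.ι ⁻¹ᵁ W ≤ U := by
      intro y hy
      obtain ⟨z, hz, hzy⟩ := leOfHom i hy
      rwa [← Subtype.ext (p := (· ∈ V)) hzy]
    let r := X.presheaf.map (homOfLE hW).op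
    refine ⟨V.ι ⁻¹ᵁ W, homOfLE hWU, hxW, fun j => r (a j), ?_⟩
    have h := congrArg (M.presheaf.map (homOfLE hW).op) ha
    refine Eq.trans ?_ (h.trans (ConcreteCategory.congr_hom
      (M.presheaf.map_comp i.op (homOfLE hW).op) m).symm)
    rw [map_sum]
    refine Finset.sum_congr rfl fun j _ => ?_
    refine (hterm _ (r (a j)) j).trans (Eq.trans ?_ (Scheme.Modules.map_smul M _ _ _).symm)
    exact congrArg (r (a j) • ·) (ConcreteCategory.congr_hom
      (M.presheaf.map_comp (i ≫ homOfLE (V.ι_image_le U)).op (homOfLE hW).op) (s j))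

end Restrict

end TauDiff

namespace TauDiff

/-! ### Local freeness of `Ω^τ_X`. -/

section LocallyFree

variable {X : Scheme.{u}} {K : Type u} [Field K] {δ : Derivation ℤ K K} (π : X ⟶ Spec (.of K))

/-- The restriction map is `appLE` of the identity morphism, which is étale. -/
theorem formallyEtale_presheaf_map {V W : X.Opens} (hV : IsAffineOpen V) (hW : IsAffineOpen W)
    (i : W ⟶ V) : (X.presheaf.map i.op).hom.FormallyEtale := by
  have h₀ : (𝟙 X : X ⟶ X).appLE V W (leOfHom i) = X.presheaf.map i.op := Category.id_comp _
  have h : (X.presheaf.map i.op).hom.Etale := h₀ ▸ (𝟙 X : X ⟶ X).etale_appLE hV hW (leOfHom i)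
  let _ := (X.presheaf.map i.op).hom.toAlgebra
  have : Algebra.Etale Γ(X, V) Γ(X, W) := h
  exact (inferInstance : Algebra.FormallyEtale Γ(X, V) Γ(X, W))

/-- `Ω^τ_X` is free of rank `n + 1` on an affine open subset on which `Ω_{X/K}` is free of
rank `n`. -/
theorem nonempty_restrict_omegaTau_iso_free [Smooth π] {e : K} (he : δ e = 1) {V : X.Opens}
    (hV : IsAffineOpen V) {n : ℕ}
    (b : Module.Basis (Fin n) Γ(X, V) (RelOmega (structureMap π (op V)))) :
    Nonempty ((OmegaTau δ π).restrict V.ι ≅ freeModule V (ULift.{u} (Fin (n + 1)))) := by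
  obtain ⟨t, ht⟩ := exists_family_basis_tauSubmodule he _ b
  have hbasis : ∀ (W : X.Opens), IsAffineOpen W → ∀ i : W ⟶ V,
      ∃ c : Module.Basis (Fin (n + 1)) Γ(X, W) (tauSubmodule δ (structureMap π (op W))),
        ∀ j, c j = tauMap δ _ _ (X.presheaf.map i.op).hom (map_comp_structureMap π i.op) (t j) :=
    fun W hW i => ht _ _ (map_comp_structureMap π i.op)
      (smooth_structureMap π hW).formallySmooth (formallyEtale_presheaf_map hV hW i)
  have hs : ∀ (U : X.Opens) (k : U ⟶ V) (j : Fin (n + 1)),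
      (OmegaTau δ π).presheaf.map k.op (sheafifySection (P := preTau δ π) (t j)) =
        sheafifySection (P := preTau δ π)
          (tauMap δ _ _ (X.presheaf.map k.op).hom (map_comp_structureMap π k.op) (t j)) :=
    fun U k j => map_sheafifySection (P := preTau δ π) k (t j)
  have hsum : ∀ (U : X.Opens) (k : U ⟶ V) (a : ULift.{u} (Fin (n + 1)) → Γ(X, U)),
      ∑ j, a j • (OmegaTau δ π).presheaf.map k.op (sheafifySection (P := preTau δ π) (t j.down)) =
        sheafifySection (P := preTau δ π) (∑ j, a j •
          tauMap δ _ _ (X.presheaf.map k.op).hom (map_comp_structureMap π k.op) (t j.down)) := by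
    intro U k a
    refine Eq.trans ?_ (map_sum ((toSheafify (preTau δ π)).app (op U)).hom _ _).symm
    refine Finset.sum_congr rfl fun j _ => ?_
    rw [hs]
    exact (sheafifySection_smul (P := preTau δ π) (a j) _).symm
  refine nonempty_restrict_iso_free
    (fun j => sheafifySection (P := preTau δ π) (t j.down)) (fun U k a ha => ?_)
    (fun U k m x hx => ?_)
  · rw [hsum] at ha
    intro j
    refine TopCat.Presheaf.IsSheaf.section_ext X.sheaf.2 fun x hx => ?_
    -- A relation in the sheaf already holds in the presheaf on some affine `W`, where the `t j`
    -- restrict to a basis.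
    obtain ⟨W, i, hW, hxW, h⟩ := exists_affine_map_eq_zero (P := preTau δ π) ha hx
    obtain ⟨c, hc⟩ := hbasis W hW (i ≫ k)
    have hcj : ∀ j, (preTau δ π).map i.op
        (tauMap δ _ _ (X.presheaf.map k.op).hom (map_comp_structureMap π k.op) (t j)) = c j :=
      fun j => (ConcreteCategory.congr_hom
        ((preTau δ π).map_comp k.op i.op) (t j)).symm.trans (hc j).symm
    have h0 : ∑ j : Fin (n + 1), X.presheaf.map i.op (a ⟨j⟩) • c j = 0 := by
      refine Eq.trans ?_ h
      refine Eq.trans ?_ (map_sum ((preTau δ π).map i.op).hom _ _).symm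
      refine Fintype.sum_equiv Equiv.ulift.symm _ _ fun j => ?_
      rw [← hcj]
      exact (PresheafOfModules.map_smul (preTau δ π) i.op (a ⟨j⟩) _).symm
    refine ⟨W, leOfHom i, hxW, ?_⟩
    refine (Fintype.linearIndependent_iff.1 c.linearIndependent _ h0 j.down).trans ?_
    exact (map_zero (X.presheaf.map i.op).hom).symm
  · obtain ⟨W, i, hW, hxW, p, hp⟩ := exists_affine_sheafifySection_eq (P := preTau δ π) m hx
    obtain ⟨c, hc⟩ := hbasis W hW (i ≫ k)
    refine ⟨W, i, hxW, fun j => c.repr p j.down, ?_⟩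
    refine (hsum W (i ≫ k) _).trans (Eq.trans ?_ hp)
    refine congrArg (sheafifySection (P := preTau δ π)) ?_
    refine Eq.trans ?_ (c.sum_repr p)
    refine (Fintype.sum_equiv Equiv.ulift _ _ fun j => ?_)
    rw [hc]
    rfl

end LocallyFree

end TauDiff

namespace TauDiff

/-! ### Dimension of a scheme from its affine opens. -/

section SchemeDimension

variable {X : Scheme.{u}}

/-- Irreducible closed subsets correspond to points, and the coheight of a point is the dimension of
its stalk. -/
theorem topologicalKrullDim_eq_iSup_stalk (X : Scheme.{u}) :
    topologicalKrullDim X = ⨆ x : X, ringKrullDim (X.presheaf.stalk x) := by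
  refine (Order.krullDim_eq_of_orderIso (irreducibleSetEquivPoints (α := X))).trans ?_
  refine Order.krullDim_eq_iSup_coheight.trans ?_
  exact iSup_congr fun x => (ringKrullDim_stalk_eq_coheight x).symm

theorem ringKrullDim_stalk_le {V : X.Opens} (hV : IsAffineOpen V) (x : V) :
    ringKrullDim (X.presheaf.stalk x.1) ≤ ringKrullDim Γ(X, V) := by
  have := hV.isLocalization_stalk x
  rw [IsLocalization.AtPrime.ringKrullDim_eq_height (hV.primeIdealOf x).asIdeal]
  exact Ideal.height_le_ringKrullDim_of_isPrime

theorem ringKrullDim_le_topologicalKrullDim {V : X.Opens} (hV : IsAffineOpen V) :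
    ringKrullDim Γ(X, V) ≤ topologicalKrullDim X := by
  rw [← PrimeSpectrum.topologicalKrullDim_eq_ringKrullDim]
  exact hV.fromSpec.isOpenEmbedding.isInducing.topologicalKrullDim_le

/-- Stalks bound `dim X` from above by the dimensions of the affine opens containing them, and any
affine open bounds it from below. -/
theorem topologicalKrullDim_eq_of_forall_exists_affine [Nonempty X] {d : WithBot ℕ∞}
    (h : ∀ x : X, ∃ V : X.Opens, IsAffineOpen V ∧ x ∈ V ∧ ringKrullDim Γ(X, V) = d) :
    topologicalKrullDim X = d := by
  refine le_antisymm ?_ ?_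
  · rw [topologicalKrullDim_eq_iSup_stalk]
    refine iSup_le fun x => ?_
    obtain ⟨V, hV, hx, rfl⟩ := h x
    exact ringKrullDim_stalk_le hV ⟨x, hx⟩
  · obtain ⟨V, hV, -, rfl⟩ := h (Classical.arbitrary X)
    exact ringKrullDim_le_topologicalKrullDim hV

end SchemeDimension

/-! ### Rank of the differentials and dimension of a smooth variety. -/

section Smooth

variable {X : Scheme.{u}} {K : Type u} [Field K] (π : X ⟶ Spec (.of K))

theorem exists_isStandardSmooth_structureMap [Smooth π] (x : X) :
    ∃ V : X.Opens, IsAffineOpen V ∧ x ∈ V ∧ (structureMap π (op V)).IsStandardSmooth := by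
  obtain ⟨U, hU, V, hV, hx, i, h⟩ := Smooth.exists_isStandardSmooth π x
  -- `Spec K` is a single point, so the base of the standard smooth chart is everything.
  have hU' : U = ⊤ := by
    have : Subsingleton (Spec (CommRingCat.of K)) :=
      inferInstanceAs (Subsingleton (PrimeSpectrum K))
    refine eq_top_iff.2 fun y _ => ?_
    rw [Subsingleton.elim y (π x)]
    exact i hx
  subst hU'
  exact ⟨V, hV, hx, RingHom.isStandardSmooth_respectsIso.2 _
    (Scheme.ΓSpecIso (.of K)).symm.commRingCatIsoToRingEquiv h⟩

theorem exists_basis_relOmega_of_isStandardSmooth {R : Type u} [CommRing R] [Nontrivial R] (φ : K →+* R)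
    (hφ : φ.IsStandardSmooth) : ∃ n, Nonempty (Module.Basis (Fin n) R (RelOmega φ)) := by
  let _ := φ.toAlgebra
  have : Algebra.IsStandardSmooth K R := hφ
  exact ⟨_, ⟨(Module.finBasis R Ω[R⁄K] : Module.Basis _ R Ω[R⁄K])⟩⟩

/-- The ring homomorphism from `K` to the function field of a `K`-scheme. -/
def functionFieldMap [IsIntegral X] : K →+* X.functionField :=
  (X.presheaf.germ ⊤ (genericPoint X) trivial).hom.comp (structureMap π (op ⊤))

/-- The dimension of an integral `K`-scheme that is smooth over `K`, as the dimension of the space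
of differentials of its function field. -/
def kaehlerRank [IsIntegral X] : ℕ :=
  letI := (functionFieldMap π).toAlgebra
  Module.finrank X.functionField Ω[X.functionField⁄K]

theorem germToFunctionField_structureMap [IsIntegral X] (V : X.Opens) [Nonempty V] :
    (X.germToFunctionField V).hom.comp (structureMap π (op V)) =
      functionFieldMap π := by
  rw [← map_comp_structureMap π (homOfLE (le_top : V ≤ ⊤)).op, ← RingHom.comp_assoc]
  exact congrArg (fun f => f.hom.comp (structureMap π (op ⊤))) (X.presheaf.germ_res _ _ _)

theorem ringKrullDim_eq_kaehlerRank [CharZero K] [IsIntegral X] [Smooth π] {V : X.Opens} (hV : IsAffineOpen V)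
    [Nonempty V] : ringKrullDim Γ(X, V) = kaehlerRank π := by
  let _ := (functionFieldMap π).toAlgebra
  let _ := (structureMap π (op V)).toAlgebra
  have : IsScalarTower K Γ(X, V) X.functionField :=
    IsScalarTower.of_algebraMap_eq' (germToFunctionField_structureMap π V).symm
  have := functionField_isFractionRing_of_isAffineOpen X V hV
  have : Algebra.FinitePresentation K Γ(X, V) := (smooth_structureMap π hV).finitePresentation
  exact ringKrullDim_eq_finrank_kaehler K Γ(X, V) X.functionField

/-- Comparison with the function field shows that the local rank of `Ω_{X/K}` does not depend on
`V`. -/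
theorem eq_kaehlerRank_of_basis [IsIntegral X] {V : X.Opens} (hV : IsAffineOpen V)
    [Nonempty V] {n : ℕ} (b : Module.Basis (Fin n) Γ(X, V) (RelOmega (structureMap π (op V)))) :
    n = kaehlerRank π := by
  let _ := (functionFieldMap π).toAlgebra
  let _ := (structureMap π (op V)).toAlgebra
  have : IsScalarTower K Γ(X, V) X.functionField :=
    IsScalarTower.of_algebraMap_eq' (germToFunctionField_structureMap π V).symm
  have := functionField_isFractionRing_of_isAffineOpen X V hV
  exact (Nat.card_fin n).symm.trans (card_basis_eq_finrank_kaehler K Γ(X, V) X.functionField b)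

theorem isLocallyFreeOfRank_omegaTau [IsIntegral X] [Smooth π] {δ : Derivation ℤ K K} {e : K}
    (he : δ e = 1) : IsLocallyFreeOfRank (OmegaTau δ π) (kaehlerRank π + 1) := by
  intro x
  obtain ⟨V, hV, hx, h⟩ := exists_isStandardSmooth_structureMap π x
  have : Nonempty V := ⟨x, hx⟩
  obtain ⟨n, ⟨b⟩⟩ := exists_basis_relOmega_of_isStandardSmooth _ h
  obtain rfl := eq_kaehlerRank_of_basis π hV b
  exact ⟨V, hx, nonempty_restrict_omegaTau_iso_free π he hV b⟩

theorem topologicalKrullDim_eq_kaehlerRank [CharZero K] [IsIntegral X] [Smooth π] :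
    topologicalKrullDim X = kaehlerRank π := by
  refine topologicalKrullDim_eq_of_forall_exists_affine fun x => ?_
  obtain ⟨_, ⟨V, hV, rfl⟩, hx, -⟩ :=
    X.isBasis_affineOpens.exists_subset_of_mem_open (Set.mem_univ x) isOpen_univ
  have : Nonempty V := ⟨x, hx⟩
  exact ⟨V, hV, hx, ringKrullDim_eq_kaehlerRank π hV⟩

end Smooth

end TauDiff

theorem mainTheorem10 {K : Type u} [Field K] [IsAlgClosed K] (δ : Derivation ℤ K K) (e : K)
    (he : δ e = 1) (X : Scheme.{u}) (π : X ⟶ Spec (.of K))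
    [AlgebraicGeometry.IsIntegral X] [IsSeparated π] [LocallyOfFiniteType π] [QuasiCompact π]
    [Smooth π] :
    (∃ (Λ : TauDiff.OmegaTau δ π ⟶ TauDiff.OmegaRel π)
        (w : TauDiff.pullbackToOmega π ≫ TauDiff.omegaToRel π = 0)
        (wτ : TauDiff.iota δ π e ≫ Λ = 0),
      (∀ (U : X.Opens) (f : Γ(X, U)), Λ.app U (TauDiff.tau δ π U f) = TauDiff.dRel π U f) ∧
      (ShortComplex.mk (TauDiff.pullbackToOmega π) (TauDiff.omegaToRel π) w).ShortExact ∧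
      (ShortComplex.mk (TauDiff.iota δ π e) Λ wτ).ShortExact ∧
      TauDiff.pullbackToOmega π ≫ TauDiff.omegaToTau δ π =
        TauDiff.deltaTilde δ π ≫ TauDiff.iota δ π e ∧
      TauDiff.omegaToTau δ π ≫ Λ = TauDiff.omegaToRel π) ∧
    ∃ r : ℕ, topologicalKrullDim X = (r : WithBot ℕ∞) ∧
      TauDiff.IsLocallyFreeOfRank (TauDiff.OmegaTau δ π) (r + 1) := by
  obtain ⟨Λ, hΛ⟩ := TauDiff.exists_tauToRel π he
  refine ⟨⟨Λ, TauDiff.pullbackToOmega_comp_omegaToRel π, TauDiff.iota_comp_tauToRel π hΛ,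
    TauDiff.tauToRel_tau π hΛ, TauDiff.upper_shortExact π, TauDiff.lower_shortExact π he hΛ,
    TauDiff.pullbackToOmega_comp_omegaToTau π he, hΛ⟩, TauDiff.kaehlerRank π, ?_,
    TauDiff.isLocallyFreeOfRank_omegaTau π he⟩
  -- Characteristic zero enters only in identifying `kaehlerRank π` with the dimension of `X`.
  have : CharZero K := TauDiff.charZero_of_derivation_eq_one δ he
  exact TauDiff.topologicalKrullDim_eq_kaehlerRank π
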